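/- Let $n\ge 2$ and identify $\mathbb R^{2n}$ with $\mathbb C^n$ by $(\xi_{11},\xi_{12},\dots,\xi_{n1},\xi_{n2})\leftrightarrow(\xi_{11}+i\xi_{12},\dots,\xi_{n1}+i\xi_{n2})$. For $\theta\in[0,2\pi]$ let $R_\theta$ be the rotation of $\mathbb R^{2n}$ that acts on each pair $(\xi_{k1},\xi_{k2})$ as the counterclockwise rotation by the angle $\theta$, and for $\xi\in S^{2n-1}$ let $H_\xi=\{z\in\mathbb C^n:\sum_k z_k\overline{\xi_k}=0\}$, a real subspace of dimension $2n-2$. A star body $K$ in $\mathbb R^{2n}$ is a compact set with the origin in its interior such that every straight line through the origin meets the boundary of $K$ in exactly two points and the Minkowski functional $\|x\|_K=\min\{a\ge 0: x\in aK\}$ is continuous. It is a complex star body if $\|R_\theta x\|_K=\|x\|_K$ for all $x$ and $\theta$, and it is origin symmetric if $K=-K$. The Fourier transform of a test function $\phi\in\mathcal S(\mathbb R^{2n})$ is $\hat\phi(y)=\int\phi(x)e^{-i\langle x,y\rangle}\,dx$. A locally integrable function $f$ with $f(x)/|x|^\beta\to0$ as $|x|\to\infty$ for some $\beta>0$ represents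 the distribution $\langle f,\phi\rangle=\int f\phi$, and its Fourier transform is the distribution $\langle\hat f,\phi\rangle=\langle f,\hat\phi\rangle$. If $\hat f$ is represented by a function of this kind that is continuous on $\mathbb R^{2n}\setminus\{0\}$, then $f^\wedge(\xi)$ denotes the value of this function at $\xi\ne0$. 1. Let $K$ be an origin symmetric complex star body in $\mathbb R^{2n}$ (with no smoothness assumption). Then the Fourier transform of $\|x\|_K^{-2n+2}$ is represented by a function continuous on $\mathbb R^{2n}\setminus\{0\}$, and for every $\xi\in S^{2n-1}$ $$|K\cap H_\xi|=\frac1{4\pi(n-1)}\left(\|x\|_K^{-2n+2}\right)^\wedge(\xi),$$ where $|K\cap H_\xi|$ is the $(2n-2)$-dimensional volume. 2. Let $f$ be an even continuous real-valued function on $S^{2n-1}$ that is invariant under all $R_\theta$, and let $f\cdot r^{-2n+2}(x)=f(x/|x|)\,|x|^{-2n+2}$. Then the Fourier transform of $f\cdot r^{-2n+2}$ is represented by a function that is continuous on $\mathbb R^{2n}\setminus\{0\}$ and even homogeneous of degree $-2$ there, and for every $\xi\in S^{2n-1}$ $$\int_{S^{2n-1}\cap H_\xi}f(x)\,dx=\frac1{2\pi}\left(f\cdot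 r^{-2n+2}\right)^\wedge(\xi),$$ where $dx$ is the surface measure of the unit sphere $S^{2n-1}\cap H_\xi$ of $H_\xi$. -/

import Mathlib

open MeasureTheory

noncomputable section

namespace ComplexBody

/-- The space `ℝ^{2n}`, whose coordinates `(x_{11}, x_{12}, …, x_{n1}, x_{n2})` are indexed by
`Fin n × Fin 2`, with the Euclidean norm. -/
abbrev R2n (n : ℕ) : Type := EuclideanSpace ℝ (Fin n × Fin 2)

/-- The `k`-th complex coordinate `x_{k1} + i x_{k2}` under the identification `ℝ^{2n} ≃ ℂⁿ`. -/
def cplx {n : ℕ} (x : R2n n) (k : Fin n) : ℂ := ⟨x (k, 0), x (k, 1)⟩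

/-- The coordinate-wise counterclockwise rotation `R_θ` of `ℝ^{2n}`. -/
def rot {n : ℕ} (θ : ℝ) (x : R2n n) : R2n n :=
  WithLp.toLp 2 fun p =>
    if p.2 = 0 then Real.cos θ * x (p.1, 0) - Real.sin θ * x (p.1, 1)
    else Real.sin θ * x (p.1, 0) + Real.cos θ * x (p.1, 1)

/-- The complex hyperplane `H_ξ = {z : ∑ z_k conj(ξ_k) = 0}` as a real subspace of `ℝ^{2n}`. -/
def hyperplane {n : ℕ} (ξ : R2n n) : Submodule ℝ (R2n n) where
  carrier := {z | ∑ k, cplx z k * starRingEnd ℂ (cplx ξ k) = 0}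
  zero_mem' := by
    have h : ∀ k : Fin n, cplx (0 : R2n n) k = 0 := fun k => by
      apply Complex.ext <;> simp [cplx]
    simp [h]
  add_mem' := by
    intro a b ha hb
    have h : ∀ k : Fin n, cplx (a + b) k = cplx a k + cplx b k := fun k => by
      apply Complex.ext <;> simp [cplx]
    simp only [Set.mem_ofPred_eq] at ha hb ⊢
    simp only [h, add_mul, Finset.sum_add_distrib, ha, hb, add_zero]
  smul_mem' := by
    intro c a ha
    have h : ∀ k : Fin n, cplx (c • a) k = (c : ℂ) * cplx a k := fun k => by
      apply Complex.ext <;> simp [cplx]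
    simp only [Set.mem_ofPred_eq] at ha ⊢
    simp only [h, mul_assoc, ← Finset.mul_sum, ha, mul_zero]

/-- Star bodies. The Minkowski functional `min {a ≥ 0 : x ∈ aK}` is Mathlib's `gauge K`. -/
structure IsStarBody {n : ℕ} (K : Set (R2n n)) : Prop where
  isCompact : IsCompact K
  zero_mem_interior : (0 : R2n n) ∈ interior K
  line_frontier : ∀ x : R2n n, x ≠ 0 →
    (frontier K ∩ {y | ∃ t : ℝ, y = t • x}).ncard = 2
  continuous_gauge : Continuous (gauge K)

/-- Complex star bodies: star bodies whose Minkowski functional is `R_θ`-invariant. -/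
structure IsComplexStarBody {n : ℕ} (K : Set (R2n n)) : Prop extends IsStarBody K where
  gauge_rot : ∀ θ ∈ Set.Icc (0 : ℝ) (2 * Real.pi), ∀ x : R2n n, gauge K (rot θ x) = gauge K x

/-- `K` is symmetric about the origin. -/
def IsOriginSymmetric {n : ℕ} (K : Set (R2n n)) : Prop := ∀ x ∈ K, -x ∈ K

/-- The `(2n-2)`-dimensional volume of the section `K ∩ H_ξ` (Lebesgue measure of the Euclidean
space `H_ξ`). -/
def sectionVolume {n : ℕ} (K : Set (R2n n)) (ξ : R2n n) : ℝ :=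
  (volume : Measure (hyperplane ξ)).real {z | (z : R2n n) ∈ K}

/-- `f` is (through its values on the unit sphere) an even function in `C_c(S^{2n-1})`, the space
of continuous `R_θ`-invariant real functions on the sphere. -/
structure IsEvenInvariantOnSphere {n : ℕ} (f : R2n n → ℝ) : Prop where
  continuousOn : ContinuousOn f (Metric.sphere 0 1)
  even : ∀ x ∈ Metric.sphere (0 : R2n n) 1, f (-x) = f x
  invariant : ∀ θ ∈ Set.Icc (0 : ℝ) (2 * Real.pi),
    ∀ x ∈ Metric.sphere (0 : R2n n) 1, f (rot θ x) = f x

/-- The complex spherical Radon transform: the integral of `f` over `S^{2n-1} ∩ H_ξ`, the unit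
sphere of `H_ξ`, with respect to its surface measure. -/
def complexRadon {n : ℕ} (f : R2n n → ℝ) (ξ : R2n n) : ℝ :=
  ∫ θ : Metric.sphere (0 : hyperplane ξ) 1, f ((θ : hyperplane ξ) : R2n n)
    ∂(volume : Measure (hyperplane ξ)).toSphere

/-- The homogeneous extension `f · r^p` of `f` from the sphere: `x ↦ f (x/|x|) |x|^p`. -/
def homExt {n : ℕ} (f : R2n n → ℝ) (p : ℤ) (x : R2n n) : ℝ := f (‖x‖⁻¹ • x) * ‖x‖ ^ p

/-- `f` is locally integrable with power growth at infinity, so that it represents the tempered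
distribution `φ ↦ ∫ f φ`. -/
def HasPowerGrowth {n : ℕ} (f : R2n n → ℂ) : Prop :=
  LocallyIntegrable f volume ∧
    ∃ β : ℝ, 0 < β ∧
      Filter.Tendsto (fun x => f x / ((‖x‖ ^ β : ℝ) : ℂ)) (Filter.cocompact (R2n n)) (nhds 0)

/-- The Fourier transform `φ̂(y) = ∫ φ(x) e^{-i⟨x,y⟩} dx` of a test function (the normalization for
which `φ̂^∧ = (2π)^{2n} φ` when `φ` is even). -/
def testFourier {n : ℕ} (φ : SchwartzMap (R2n n) ℂ) (y : R2n n) : ℂ :=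
  ∫ x : R2n n, φ x * Complex.exp (-Complex.I * ((inner ℝ x y : ℝ) : ℂ))

/-- The Fourier transform of the distribution represented by the function `f` is the distribution
represented by `g`, that is `⟨g, φ⟩ = ⟨f, φ̂⟩` for all test functions `φ`, and `g` is continuous
outside the origin. Such a `g` is determined by `f` outside the origin, and for `ξ ≠ 0` its value
`g ξ` is what is denoted by `f^∧(ξ)`. -/
structure IsFourierFunction {n : ℕ} (f g : R2n n → ℂ) : Prop where
  growth_left : HasPowerGrowth f
  growth_right : HasPowerGrowth g
  pairing : ∀ φ : SchwartzMap (R2n n) ℂ, ∫ x, g x * φ x = ∫ x, f x * testFourier φ x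
  continuousOn : ContinuousOn g {x | x ≠ 0}

/-- `g` is even homogeneous of degree `p` outside the origin. -/
def IsEvenHomogeneous {n : ℕ} (g : R2n n → ℂ) (p : ℤ) : Prop :=
  ∀ (t : ℝ) (x : R2n n), t ≠ 0 → x ≠ 0 → g (t • x) = ((|t| ^ p : ℝ) : ℂ) * g x

end ComplexBody

end

open MeasureTheory

noncomputable section

namespace ComplexBody

/-! Both functions in the theorem have the form F(x) = q(x)|x|^{-2n+2}, where q is bounded,
continuous off the origin and invariant under nonzero complex scalars (`IsProjective`). The claim to
prove is that F has Fourier transform 2π|y|⁻² ∫_{S ∩ H_y} q; homogeneity and both formulas follow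
from it.

Damp F by exp(-ε|x|²/2). Up to the factor π/n, |x|^{-2n} is the integral of |c|^{-2n-2} over the
complex numbers c with |c| ≥ |x|. Insert this, exchange the integrals and replace x by cx.
Invariance of q confines x to the unit ball and leaves a Gaussian integral over the complex line ℂx,
which is explicit. Hence the damped transform is (2n/ε) ∫_{|x|≤1} q(x) exp(-|x·ȳ|²/(2ε|x|²)) dx, the
content of `IsProjective.integral_homogeneous_mul_dampedExp`.

As ε → 0 this Gaussian concentrates on H_y. In oblique coordinates H_e × ℂ, with the ℂ-variable
rescaled by √ε, one integrable majorant serves all small ε and all y near y₀. Dominated convergence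
then gives a limit joint in (ε, y) (`IsProjective.tendsto_gaussReg`), hence both the value and the
continuity of the transform, with no smoothness of q. The uniform bound C|y|⁻² carries the limit
through pairings with test functions (`IsProjective.pairing`).

For a star body, `IsStarBody.mem_iff_gauge_le_one` identifies K with the unit sublevel set of its
gauge, and polar coordinates in H_ξ express the section volume as a spherical integral.
`IsFourierFunction.eq_of_ne_zero` transfers the result to every admissible representative. -/

variable {n : ℕ}

/-! ### The complex structure of ℝ^{2n}. -/

/-- The Hermitian form `∑ x_k conj(y_k)` on `ℝ^{2n} = ℂⁿ`. -/
def hdot (x y : R2n n) : ℂ := ∑ k, cplx x k * starRingEnd ℂ (cplx y k)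

/-- Multiplication of a vector of `ℝ^{2n} = ℂⁿ` by a complex number. -/
def cmul (c : ℂ) (x : R2n n) : R2n n :=
  WithLp.toLp 2 fun p =>
    if p.2 = 0 then c.re * x (p.1, 0) - c.im * x (p.1, 1)
    else c.im * x (p.1, 0) + c.re * x (p.1, 1)

lemma cplx_cmul (c : ℂ) (x : R2n n) (k : Fin n) : cplx (cmul c x) k = c * cplx x k := by
  apply Complex.ext <;> simp [cplx, cmul]; ring

lemma cplx_add (x y : R2n n) (k : Fin n) : cplx (x + y) k = cplx x k + cplx y k := by
  apply Complex.ext <;> simp [cplx]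

lemma cplx_smul (c : ℝ) (x : R2n n) (k : Fin n) : cplx (c • x) k = c * cplx x k := by
  apply Complex.ext <;> simp [cplx]

lemma cplx_injective {x y : R2n n} (h : ∀ k, cplx x k = cplx y k) : x = y := by
  ext ⟨k, j⟩
  have := h k
  simp only [cplx, Complex.mk.injEq] at this
  fin_cases j
  · exact this.1
  · exact this.2

lemma inner_eq_re_hdot (x y : R2n n) : inner ℝ x y = (hdot x y).re := by
  simp [PiLp.inner_apply, Fintype.sum_prod_type, hdot, cplx]
  refine Finset.sum_congr rfl fun k _ => by ring

lemma hdot_self (x : R2n n) : hdot x x = ((‖x‖ ^ 2 : ℝ) : ℂ) := by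
  apply Complex.ext
  · rw [← inner_eq_re_hdot, real_inner_self_eq_norm_sq, Complex.ofReal_re]
  · rw [Complex.ofReal_im]
    simp only [hdot, cplx, Complex.im_sum]
    refine Finset.sum_eq_zero fun k _ => by simp; ring

lemma hdot_add_left (x y z : R2n n) : hdot (x + y) z = hdot x z + hdot y z := by
  simp [hdot, cplx_add, add_mul, Finset.sum_add_distrib]

lemma hdot_cmul_left (c : ℂ) (x y : R2n n) : hdot (cmul c x) y = c * hdot x y := by
  simp [hdot, cplx_cmul, Finset.mul_sum, mul_assoc]

lemma hdot_smul_left (c : ℝ) (x y : R2n n) : hdot (c • x) y = c * hdot x y := by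
  simp [hdot, cplx_smul, Finset.mul_sum, mul_assoc]

lemma hdot_conj (x y : R2n n) : starRingEnd ℂ (hdot x y) = hdot y x := by
  simp [hdot, mul_comm]

lemma hdot_smul_right (c : ℝ) (x y : R2n n) : hdot x (c • y) = c * hdot x y := by
  rw [← hdot_conj, hdot_smul_left, map_mul, hdot_conj, Complex.conj_ofReal]

lemma mem_hyperplane {x y : R2n n} : x ∈ hyperplane y ↔ hdot x y = 0 := Iff.rfl

lemma norm_cmul (c : ℂ) (x : R2n n) : ‖cmul c x‖ = ‖c‖ * ‖x‖ := by
  have h : ((‖cmul c x‖ ^ 2 : ℝ) : ℂ) = (((‖c‖ * ‖x‖) ^ 2 : ℝ) : ℂ) := by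
    rw [← hdot_self, hdot_cmul_left, ← hdot_conj, hdot_cmul_left, map_mul, hdot_conj, hdot_self,
      ← mul_assoc, Complex.mul_conj, Complex.normSq_eq_norm_sq]
    push_cast; ring
  exact (sq_eq_sq₀ (norm_nonneg _) (by positivity)).1 (by exact_mod_cast h)

/-- Displays the phase along the complex line ℂx as a real linear functional of c, the form needed
for Gaussian integrals over ℂ. -/
lemma inner_cmul (c : ℂ) (x y : R2n n) :
    inner ℝ (cmul c x) y = inner ℝ (starRingEnd ℂ (hdot x y)) c := by
  rw [inner_eq_re_hdot, hdot_cmul_left, Complex.inner]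
  simp

lemma cmul_add (c : ℂ) (x y : R2n n) : cmul c (x + y) = cmul c x + cmul c y :=
  cplx_injective fun k => by simp only [cplx_add, cplx_cmul]; ring

lemma add_cmul (c d : ℂ) (x : R2n n) : cmul (c + d) x = cmul c x + cmul d x :=
  cplx_injective fun k => by simp only [cplx_add, cplx_cmul]; ring

lemma cmul_smul (c : ℂ) (r : ℝ) (x : R2n n) : cmul c (r • x) = r • cmul c x :=
  cplx_injective fun k => by simp only [cplx_smul, cplx_cmul]; ring

lemma smul_cmul (r : ℝ) (c : ℂ) (x : R2n n) : cmul (r • c) x = r • cmul c x :=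
  cplx_injective fun k => by simp only [cplx_smul, cplx_cmul, Complex.real_smul]; ring

lemma cmul_cmul (c d : ℂ) (x : R2n n) : cmul c (cmul d x) = cmul (c * d) x :=
  cplx_injective fun k => by simp only [cplx_cmul]; ring

lemma one_cmul (x : R2n n) : cmul 1 x = x :=
  cplx_injective fun k => by simp only [cplx_cmul, one_mul]

lemma zero_cmul (x : R2n n) : cmul 0 x = 0 := by
  rw [← norm_eq_zero, norm_cmul, norm_zero, zero_mul]

lemma cmul_ofReal (r : ℝ) (x : R2n n) : cmul r x = r • x :=
  cplx_injective fun k => by simp only [cplx_cmul, cplx_smul]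

lemma rot_eq_cmul (θ : ℝ) (x : R2n n) : rot θ x = cmul (Complex.exp (θ * Complex.I)) x := by
  simp only [rot, cmul, Complex.exp_ofReal_mul_I_re, Complex.exp_ofReal_mul_I_im]

/-- Multiplication by a complex number of modulus one as a linear isometry. -/
def unitIsometry (c : ℂ) (hc : ‖c‖ = 1) : R2n n ≃ₗᵢ[ℝ] R2n n where
  toFun := cmul c
  map_add' := cmul_add c
  map_smul' r x := cmul_smul c r x
  invFun := cmul c⁻¹
  left_inv x := by
    have : c ≠ 0 := by rintro rfl; simp at hc
    rw [cmul_cmul, inv_mul_cancel₀ this, one_cmul]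
  right_inv x := by
    have : c ≠ 0 := by rintro rfl; simp at hc
    rw [cmul_cmul, mul_inv_cancel₀ this, one_cmul]
  norm_map' x := by
    change ‖cmul c x‖ = ‖x‖
    rw [norm_cmul, hc, one_mul]

lemma continuous_hdot : Continuous fun p : R2n n × R2n n => hdot p.1 p.2 := by
  have h : ∀ k, Continuous fun x : R2n n => cplx x k := fun k => by
    have : (fun x : R2n n => cplx x k) =
        fun x : R2n n => ((x (k, 0) : ℝ) : ℂ) + (x (k, 1) : ℝ) * Complex.I := by
      funext x; apply Complex.ext <;> simp [cplx]
    rw [this]; fun_prop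
  unfold hdot
  refine continuous_finsetSum _ fun k _ => ?_
  exact ((h k).comp continuous_fst).mul
    (Complex.continuous_conj.comp ((h k).comp continuous_snd))

lemma continuous_cmul : Continuous fun p : ℂ × R2n n => cmul p.1 p.2 := by
  unfold cmul
  refine (PiLp.continuous_toLp 2 _).comp (continuous_pi fun p => ?_)
  split_ifs
  · exact ((Complex.continuous_re.comp continuous_fst).mul (by fun_prop)).sub
      ((Complex.continuous_im.comp continuous_fst).mul (by fun_prop))
  · exact ((Complex.continuous_im.comp continuous_fst).mul (by fun_prop)).add
      ((Complex.continuous_re.comp continuous_fst).mul (by fun_prop))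

lemma finrank_R2n : Module.finrank ℝ (R2n n) = 2 * n := by
  simp; ring

/-- A nonzero complex scalar is a dilation by ‖c‖ composed with an isometry, so only the dilation
contributes a Jacobian. -/
lemma integral_comp_cmul {F : Type*} [NormedAddCommGroup F] [NormedSpace ℝ F]
    (G : R2n n → F) {c : ℂ} (hc : c ≠ 0) :
    ∫ x, G (cmul c x) = (‖c‖ ^ (2 * n))⁻¹ • ∫ x, G x := by
  have hu : ‖c / (‖c‖ : ℂ)‖ = 1 := by simp [hc]
  have h1 : ∀ x : R2n n, cmul c x = ‖c‖ • unitIsometry _ hu x := fun x => by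
    change _ = ‖c‖ • cmul _ x
    rw [← cmul_ofReal, cmul_cmul, mul_div_cancel₀ _ (by simpa using hc)]
  simp_rw [h1]
  rw [(unitIsometry (n := n) _ hu).measurePreserving.integral_comp
    (unitIsometry (n := n) _ hu).toHomeomorph.measurableEmbedding (fun x => G (‖c‖ • x)),
    Measure.integral_comp_smul, finrank_R2n, abs_of_nonneg (by positivity)]

/-- The isometry `H_e × ℂ ≃ ℝ^{2n}`, `(u, z) ↦ u + z e`, for a unit vector `e`. -/
def splitIsometry (e : R2n n) (he : ‖e‖ = 1) : WithLp 2 (hyperplane e × ℂ) ≃ₗᵢ[ℝ] R2n n where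
  toFun p := (p.fst : R2n n) + cmul p.snd e
  map_add' p q := by
    simp only [WithLp.add_fst, WithLp.add_snd, Submodule.coe_add, add_cmul]; abel
  map_smul' r p := by
    simp only [WithLp.smul_fst, WithLp.smul_snd, Submodule.coe_smul, smul_cmul, RingHom.id_apply,
      smul_add]
  invFun x := WithLp.toLp 2 (⟨x + cmul (-hdot x e) e, by
    rw [mem_hyperplane, hdot_add_left, hdot_cmul_left, hdot_self, he]; simp⟩, hdot x e)
  left_inv p := by
    have h : hdot ((p.fst : R2n n) + cmul p.snd e) e = p.snd := by
      rw [hdot_add_left, hdot_cmul_left, hdot_self, he, mem_hyperplane.1 p.fst.2]; simp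
    have h2 : (p.fst : R2n n) + cmul p.snd e + cmul (-p.snd) e = p.fst := by
      rw [add_assoc, ← add_cmul, add_neg_cancel, zero_cmul, add_zero]
    apply (WithLp.ofLp_injective 2)
    refine Prod.ext (Subtype.ext ?_) h
    simpa [h] using h2
  right_inv x := by
    change x + cmul (-hdot x e) e + cmul (hdot x e) e = x
    rw [add_assoc, ← add_cmul, neg_add_cancel, zero_cmul, add_zero]
  norm_map' p := by
    change ‖(p.fst : R2n n) + cmul p.snd e‖ = ‖p‖
    have h0 : inner ℝ (p.fst : R2n n) (cmul p.snd e) = 0 := by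
      rw [inner_eq_re_hdot, ← hdot_conj, hdot_cmul_left, map_mul, hdot_conj,
        mem_hyperplane.1 p.fst.2]; simp
    have h1 := norm_add_sq_eq_norm_sq_add_norm_sq_of_inner_eq_zero _ _ h0
    have h2 := WithLp.prod_norm_sq_eq_of_L2 p
    rw [norm_cmul, he, mul_one] at h1
    refine (sq_eq_sq₀ (norm_nonneg _) (norm_nonneg _)).1 ?_
    rw [h2, sq, h1, Submodule.coe_norm]; ring

lemma measurePreserving_split (e : R2n n) (he : ‖e‖ = 1) :
    MeasurePreserving (fun p : hyperplane e × ℂ => (p.1 : R2n n) + cmul p.2 e) :=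
  (splitIsometry e he).measurePreserving.comp (WithLp.volume_preserving_toLp _ _)

lemma measurableEmbedding_split (e : R2n n) (he : ‖e‖ = 1) :
    MeasurableEmbedding (fun p : hyperplane e × ℂ => (p.1 : R2n n) + cmul p.2 e) :=
  (splitIsometry e he).toHomeomorph.measurableEmbedding.comp
    (MeasurableEquiv.toLp 2 (hyperplane e × ℂ)).measurableEmbedding

lemma finrank_hyperplane_of_norm_one (e : R2n n) (he : ‖e‖ = 1) :
    Module.finrank ℝ (hyperplane e) = 2 * n - 2 := by
  have h := (splitIsometry e he).toLinearEquiv.finrank_eq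
  rw [(WithLp.linearEquiv 2 ℝ (hyperplane e × ℂ)).finrank_eq, Module.finrank_prod,
    Complex.finrank_real_complex, finrank_R2n] at h
  omega

lemma hyperplane_smul (y : R2n n) {c : ℝ} (hc : c ≠ 0) : hyperplane (c • y) = hyperplane y := by
  ext x
  rw [mem_hyperplane, mem_hyperplane, hdot_smul_right]
  simp [hc]

/-! ### Polar coordinates. -/

section Polar

open Set Metric

variable {V : Type*} [NormedAddCommGroup V] [NormedSpace ℝ V] [FiniteDimensional ℝ V]
  [Nontrivial V] [MeasurableSpace V] [BorelSpace V] (μ : Measure V) [μ.IsAddHaarMeasure]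

/-- Integration in polar coordinates. -/
lemma integral_polar (G : V → ℝ) (hG : Integrable G μ) :
    ∫ x, G x ∂μ = ∫ θ : sphere (0 : V) 1,
      (∫ r in Ioi (0 : ℝ), r ^ (Module.finrank ℝ V - 1) * G (r • (θ : V))) ∂μ.toSphere := by
  have hmp := (μ.measurePreserving_homeomorphUnitSphereProd)
  have hemb := (homeomorphUnitSphereProd V).measurableEmbedding
  have hval : ∀ x : ({0}ᶜ : Set V), (homeomorphUnitSphereProd V x).2.1 •
      ((homeomorphUnitSphereProd V x).1 : V) = x := fun x => by
    conv_rhs => rw [← (homeomorphUnitSphereProd V).symm_apply_apply x]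
    rfl
  set G' : sphere (0 : V) 1 × Ioi (0 : ℝ) → ℝ := fun p => G (p.2.1 • (p.1 : V)) with hG'
  have e1 : ∫ x, G x ∂μ = ∫ p, G' p ∂μ.toSphere.prod (.volumeIoiPow (Module.finrank ℝ V - 1)) := by
    rw [← hmp.integral_comp hemb]
    simp only [hG', hval]
    rw [integral_subtype_comap (measurableSet_singleton _).compl, restrict_compl_singleton]
  have hint : Integrable G' (μ.toSphere.prod (.volumeIoiPow (Module.finrank ℝ V - 1))) := by
    rw [← hmp.integrable_comp_emb hemb]
    have : G' ∘ homeomorphUnitSphereProd V = G ∘ Subtype.val := by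
      funext x; simp only [hG', Function.comp, hval]
    rw [this, ← integrableOn_iff_comap_subtypeVal (measurableSet_singleton _).compl]
    exact hG.integrableOn
  rw [e1, integral_prod _ hint]
  refine integral_congr_ae (.of_forall fun θ => ?_)
  simp only [Measure.volumeIoiPow, ENNReal.ofReal]
  rw [integral_withDensity_eq_integral_smul]
  · rw [integral_subtype_comap measurableSet_Ioi
      fun a ↦ Real.toNNReal (a ^ (Module.finrank ℝ V - 1)) • G (a • (θ : V))]
    refine setIntegral_congr_fun measurableSet_Ioi fun x hx ↦ ?_
    simp only [NNReal.smul_def, Real.coe_toNNReal _ (pow_nonneg (le_of_lt hx) _), smul_eq_mul]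
  · exact (measurable_subtype_coe.pow_const _).real_toNNReal

lemma integral_Ioi_indicator_pow (m : ℕ) {a : ℝ} (ha : 0 ≤ a) :
    ∫ r in Ioi (0 : ℝ), (Iic a).indicator (fun r => r ^ m) r = a ^ (m + 1) / (m + 1) := by
  rw [integral_indicator measurableSet_Iic, Measure.restrict_restrict measurableSet_Iic,
    inter_comm, Ioi_inter_Iic, ← intervalIntegral.integral_of_le ha, integral_pow]
  simp

/-- The radial factor is ∫₀¹ r^{d+1} dr = 1/(d+2), with d the real dimension. It recovers the
spherical Radon transform from a ball integral over the hyperplane. -/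
lemma integral_ball_mul_norm_sq (q : V → ℝ) (hqm : Measurable q) {M : ℝ} (hqM : ∀ x, |q x| ≤ M)
    (hq : ∀ (r : ℝ) (x : V), 0 < r → q (r • x) = q x) :
    ∫ x, (closedBall (0 : V) 1).indicator (fun x => q x * ‖x‖ ^ 2) x ∂μ =
      (∫ θ : sphere (0 : V) 1, q θ ∂μ.toSphere) / (Module.finrank ℝ V + 2) := by
  have hd : 0 < Module.finrank ℝ V := Module.finrank_pos
  rw [integral_polar]
  · rw [← integral_div]
    refine integral_congr_ae (.of_forall fun θ => ?_)
    have hθ : ‖(θ : V)‖ = 1 := by simp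
    have : ∀ r ∈ Ioi (0 : ℝ), r ^ (Module.finrank ℝ V - 1) *
        (closedBall (0 : V) 1).indicator (fun x => q x * ‖x‖ ^ 2) (r • (θ : V)) =
        q θ * (Iic 1).indicator (fun r => r ^ (Module.finrank ℝ V + 1)) r := fun r hr => by
      have hr : 0 < r := hr
      have hn : ‖r • (θ : V)‖ = r := by rw [norm_smul, hθ, mul_one, Real.norm_of_nonneg hr.le]
      by_cases h1 : r ≤ 1
      · rw [indicator_of_mem (by simpa [hn] using h1), indicator_of_mem (by simpa using h1),
          hq r _ hr, hn]
        obtain ⟨k, hk⟩ : ∃ k, Module.finrank ℝ V = k + 1 := ⟨_, (Nat.succ_pred_eq_of_pos hd).symm⟩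
        rw [hk]; simp; ring
      · rw [indicator_of_notMem (by simpa [hn] using h1), indicator_of_notMem (by simpa using h1)]
        simp
    simp only
    rw [setIntegral_congr_fun measurableSet_Ioi this, integral_const_mul,
      integral_Ioi_indicator_pow _ zero_le_one]
    push_cast
    rw [one_pow, mul_one_div]
    ring_nf
  · rw [integrable_indicator_iff measurableSet_closedBall]
    refine Measure.integrableOn_of_bounded (M := M) measure_closedBall_lt_top.ne
      (by fun_prop) ?_
    refine (ae_restrict_iff' measurableSet_closedBall).2 (.of_forall fun x hx => ?_)
    rw [mem_closedBall_zero_iff] at hx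
    rw [norm_mul, Real.norm_eq_abs]
    calc |q x| * ‖‖x‖ ^ 2‖ ≤ M * 1 := by
          refine mul_le_mul (hqM x) ?_ (norm_nonneg _) ((abs_nonneg _).trans (hqM x))
          rw [norm_pow, norm_norm]
          exact pow_le_one₀ (norm_nonneg x) hx
      _ = M := mul_one M

/-- On the ray through θ the set is 0 < r ≤ 1/γ(θ), and ∫ r^{d-1} dr over it is γ(θ)^{-d}/d. -/
lemma measureReal_sublevel (γ : V → ℝ) (hγ : Continuous γ) (hpos : ∀ x, x ≠ 0 → 0 < γ x)
    (hhom : ∀ (r : ℝ) (x : V), 0 < r → γ (r • x) = r * γ x) (hfin : μ {x | γ x ≤ 1} ≠ ⊤) :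
    μ.real {x | γ x ≤ 1} =
      (∫ θ : sphere (0 : V) 1, ((γ θ) ^ Module.finrank ℝ V)⁻¹ ∂μ.toSphere) /
        Module.finrank ℝ V := by
  have hd : 0 < Module.finrank ℝ V := Module.finrank_pos
  have hm : MeasurableSet {x | γ x ≤ 1} := measurableSet_le hγ.measurable measurable_const
  rw [← integral_indicator_one hm, integral_polar]
  · rw [← integral_div]
    refine integral_congr_ae (.of_forall fun θ => ?_)
    have hθ : 0 < γ (θ : V) := hpos _ (ne_zero_of_mem_unit_sphere θ)
    have : ∀ r ∈ Ioi (0 : ℝ), r ^ (Module.finrank ℝ V - 1) *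
        ({x | γ x ≤ 1}).indicator 1 (r • (θ : V)) =
        (Iic (γ θ)⁻¹).indicator (fun r => r ^ (Module.finrank ℝ V - 1)) r := fun r hr => by
      have hr : 0 < r := hr
      have hiff : r • (θ : V) ∈ {x | γ x ≤ 1} ↔ r ≤ (γ θ)⁻¹ := by
        rw [Set.mem_ofPred_eq, hhom r _ hr, ← le_div_iff₀ hθ, one_div]
      by_cases h1 : r ≤ (γ θ)⁻¹
      · rw [indicator_of_mem (hiff.2 h1), indicator_of_mem (by simpa using h1)]; simp
      · rw [indicator_of_notMem (fun h => h1 (hiff.1 h)), indicator_of_notMem (by simpa using h1)]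
        simp
    simp only
    rw [setIntegral_congr_fun measurableSet_Ioi this,
      integral_Ioi_indicator_pow _ (inv_nonneg.2 hθ.le), Nat.sub_add_cancel hd, inv_pow,
      Nat.cast_pred hd, sub_add_cancel]
  · exact (integrable_indicator_iff hm).2 (integrableOn_const hfin)

end Polar

/-! ### Gaussian integrals over complex lines and the tail weight. -/

open Set Metric Complex Filter Topology

/-- The damped exponential `exp(-ε|x|²/2 - i⟨x,y⟩)`. -/
def dampedExp (ε : ℝ) (y x : R2n n) : ℂ :=
  cexp (-(ε / 2 : ℝ) * ‖x‖ ^ 2 - I * (inner ℝ x y : ℝ))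

lemma continuous_dampedExp (ε : ℝ) (y : R2n n) : Continuous (dampedExp ε y) := by
  unfold dampedExp; fun_prop

lemma norm_dampedExp (ε : ℝ) (y x : R2n n) :
    ‖dampedExp ε y x‖ = Real.exp (-(ε / 2) * ‖x‖ ^ 2) := by
  rw [dampedExp, norm_exp]
  congr 1
  simp [← ofReal_pow]

lemma integral_dampedExp_line {ε : ℝ} (hε : 0 < ε) (y : R2n n) {x : R2n n} (hx : x ≠ 0) :
    ∫ c : ℂ, dampedExp ε y (cmul c x) =
      ((2 * Real.pi / (ε * ‖x‖ ^ 2) *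
        Real.exp (-‖hdot x y‖ ^ 2 / (2 * ε * ‖x‖ ^ 2)) : ℝ) : ℂ) := by
  have hx' : 0 < ‖x‖ := norm_pos_iff.2 hx
  have hb : 0 < (((ε / 2 * ‖x‖ ^ 2 : ℝ)) : ℂ).re := by rw [ofReal_re]; positivity
  have h := GaussianFourier.integral_cexp_neg_mul_sq_norm_add hb (-I)
    (starRingEnd ℂ (hdot x y))
  have e : ∀ c : ℂ, dampedExp ε y (cmul c x) = cexp (-((ε / 2 * ‖x‖ ^ 2 : ℝ) : ℂ) * ‖c‖ ^ 2 +
      -I * (inner ℝ (starRingEnd ℂ (hdot x y)) c : ℝ)) := fun c => by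
    rw [dampedExp, inner_cmul, norm_cmul]
    congr 1
    push_cast; ring
  simp_rw [e]
  rw [h, finrank_real_complex]
  -- The Gaussian integral carries the power dim/2; here dim = 2, so the complex power is trivial.
  have h1 : (((2 : ℕ) : ℂ) / 2) = 1 := by norm_num
  rw [h1, cpow_one]
  have hxc : (‖x‖ : ℂ) ≠ 0 := by exact_mod_cast hx'.ne'
  have hεc : (ε : ℂ) ≠ 0 := by exact_mod_cast hε.ne'
  push_cast
  congr 1
  · field_simp
  · congr 1
    rw [neg_sq, I_sq, norm_conj]
    field_simp
    ring

lemma integrable_dampedExp_line {ε : ℝ} (hε : 0 < ε) (y : R2n n) {x : R2n n} (hx : x ≠ 0) :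
    Integrable fun c : ℂ => dampedExp ε y (cmul c x) := by
  have hx' : 0 < ‖x‖ := norm_pos_iff.2 hx
  have hb : 0 < (((ε / 2 * ‖x‖ ^ 2 : ℝ)) : ℂ).re := by rw [ofReal_re]; positivity
  refine (GaussianFourier.integrable_cexp_neg_mul_sq_norm_add hb (-I)
    (starRingEnd ℂ (hdot x y))).congr (.of_forall fun c => ?_)
  simp only
  rw [dampedExp, inner_cmul, norm_cmul]
  congr 1
  push_cast; ring

lemma integral_norm_dampedExp_line {ε : ℝ} (hε : 0 < ε) (y : R2n n) {x : R2n n} (hx : x ≠ 0) :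
    ∫ c : ℂ, ‖dampedExp ε y (cmul c x)‖ = 2 * Real.pi / (ε * ‖x‖ ^ 2) := by
  have hx' : 0 < ‖x‖ := norm_pos_iff.2 hx
  have e : ∀ c : ℂ, ‖dampedExp ε y (cmul c x)‖ = Real.exp (-(ε / 2 * ‖x‖ ^ 2) * ‖c‖ ^ 2) :=
    fun c => by
      rw [norm_dampedExp, norm_cmul]; congr 1; ring
  simp_rw [e]
  rw [GaussianFourier.integral_rexp_neg_mul_sq_norm (by positivity), finrank_real_complex]
  norm_num
  field_simp

/-- The weight `1_{|c| ≥ a} |c|^{-2n-2}` on `ℂ`. -/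
def tailWeight (n : ℕ) (a : ℝ) (c : ℂ) : ℝ :=
  (Ici a).indicator (fun t : ℝ => (t ^ (2 * n + 2))⁻¹) ‖c‖

lemma tailWeight_nonneg (n : ℕ) (a : ℝ) (c : ℂ) : 0 ≤ tailWeight n a c :=
  indicator_apply_nonneg fun _ => by positivity

lemma tail_pow_eq {n : ℕ} {t : ℝ} (ht : 0 < t) :
    t * (t ^ (2 * n + 2))⁻¹ = t ^ (-(2 * n + 1) : ℝ) := by
  rw [Real.rpow_neg ht.le]
  have : (2 * n + 1 : ℝ) = ((2 * n + 1 : ℕ) : ℝ) := by push_cast; ring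
  rw [this, Real.rpow_natCast]
  field_simp
  ring

lemma integrable_tailWeight {n : ℕ} (hn : 1 ≤ n) {a : ℝ} (ha : 0 < a) :
    Integrable (tailWeight n a) := by
  have hn' : (1 : ℝ) ≤ n := by exact_mod_cast hn
  unfold tailWeight
  rw [integrable_fun_norm_addHaar volume (f := (Ici a).indicator (fun t : ℝ => (t ^ (2 * n + 2))⁻¹)),
    finrank_real_complex]
  have h := (integrableOn_Ioi_rpow_of_lt (a := -(2 * n + 1 : ℝ)) (by linarith) ha)
  rw [← integrableOn_Ici_iff_integrableOn_Ioi, ← integrable_indicator_iff measurableSet_Ici] at h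
  refine h.integrableOn.congr_fun (fun t ht => ?_) measurableSet_Ioi
  have ht : 0 < t := ht
  by_cases h1 : a ≤ t
  · rw [indicator_of_mem (by simpa using h1), indicator_of_mem (by simpa using h1),
      ← tail_pow_eq ht]; simp
  · rw [indicator_of_notMem (by simpa using h1), indicator_of_notMem (by simpa using h1)]; simp

/-- In polar coordinates on ℂ this is 2π ∫_a^∞ t^{-2n-1} dt. It serves to write |x|^{-2n} as a
superposition over complex scalars. -/
lemma integral_tailWeight {n : ℕ} (hn : 1 ≤ n) {a : ℝ} (ha : 0 < a) :
    ∫ c, tailWeight n a c = Real.pi / n * (a ^ (2 * n))⁻¹ := by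
  have hn' : (1 : ℝ) ≤ n := by exact_mod_cast hn
  unfold tailWeight
  rw [integral_fun_norm_addHaar volume (f := (Ici a).indicator (fun t : ℝ => (t ^ (2 * n + 2))⁻¹)),
    finrank_real_complex]
  have : ∀ t ∈ Ioi (0 : ℝ), t ^ (2 - 1) • (Ici a).indicator (fun t : ℝ => (t ^ (2 * n + 2))⁻¹) t =
      (Ici a).indicator (fun t : ℝ => t ^ (-(2 * n + 1) : ℝ)) t := fun t ht => by
    have ht : 0 < t := ht
    by_cases h1 : a ≤ t
    · rw [indicator_of_mem (by simpa using h1), indicator_of_mem (by simpa using h1),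
        ← tail_pow_eq ht]; simp
    · rw [indicator_of_notMem (by simpa using h1), indicator_of_notMem (by simpa using h1)]; simp
  rw [setIntegral_congr_fun measurableSet_Ioi this, integral_indicator measurableSet_Ici,
    Measure.restrict_restrict measurableSet_Ici,
    inter_eq_left.2 (Ici_subset_Ioi.2 ha), integral_Ici_eq_integral_Ioi,
    integral_Ioi_rpow_of_lt (by linarith) ha, Measure.real, Complex.volume_ball]
  have h2 : (-(2 * n + 1 : ℝ) + 1) = -((2 * n : ℕ) : ℝ) := by push_cast; ring
  rw [h2, Real.rpow_neg ha.le, Real.rpow_natCast]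
  simp
  field_simp

/-- Inside the unit ball A is integrable and B bounded; outside it A is bounded and B integrable. -/
lemma integrable_mul_of_norm_le_rpow {V : Type*} [NormedAddCommGroup V] [NormedSpace ℝ V]
    [FiniteDimensional ℝ V] [MeasurableSpace V] [BorelSpace V] {μ : Measure V}
    [μ.IsAddHaarMeasure] (hd : 1 ≤ Module.finrank ℝ V) {A B : V → ℂ} {C D α : ℝ} (hα0 : 0 ≤ α)
    (hα : α < Module.finrank ℝ V) (hA : ∀ x, x ≠ 0 → ‖A x‖ ≤ C * ‖x‖ ^ (-α))
    (hAm : AEStronglyMeasurable A μ) (hB : Integrable B μ) (hBD : ∀ x, ‖B x‖ ≤ D) :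
    Integrable (fun x => A x * B x) μ := by
  have : Nontrivial V := Module.nontrivial_of_finrank_pos (R := ℝ) (by omega)
  have hC : 0 ≤ C := by
    obtain ⟨x, hx⟩ := exists_ne (0 : V)
    exact nonneg_of_mul_nonneg_left ((norm_nonneg _).trans (hA x hx))
      (Real.rpow_pos_of_pos (norm_pos_iff.2 hx) _)
  have hAloc : IntegrableOn A (ball 0 1) μ :=
    integrableOn_ball_of_norm_le_rpow hd hα (ae_restrict_of_ae <| by
      filter_upwards [Measure.ae_ne μ 0] with x hx using hA x hx) hAm
  refine Integrable.mono' (g := fun x => (ball (0 : V) 1).indicator (fun x => ‖A x‖) x * D +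
    C * ‖B x‖) ((((integrable_indicator_iff measurableSet_ball).2 hAloc.norm).mul_const D).add
      (hB.norm.const_mul C)) (hAm.mul hB.aestronglyMeasurable) (.of_forall fun x => ?_)
  rw [norm_mul]
  by_cases hx : x ∈ ball (0 : V) 1
  · rw [indicator_of_mem hx]
    have := mul_le_mul_of_nonneg_left (hBD x) (norm_nonneg (A x))
    have : 0 ≤ C * ‖B x‖ := by positivity
    linarith
  · rw [indicator_of_notMem hx, zero_mul, zero_add]
    have hx1 : 1 ≤ ‖x‖ := by simpa using hx
    refine mul_le_mul_of_nonneg_right ?_ (norm_nonneg _)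
    refine (hA x (norm_pos_iff.1 (by linarith))).trans ?_
    exact mul_le_of_le_one_right hC (Real.rpow_le_one_of_one_le_of_nonpos hx1 (by linarith))

/-! ### The damped transform in closed form. -/

/-- Bounded functions on `ℂⁿ` that are continuous off the origin and invariant under
multiplication by nonzero complex numbers. -/
structure IsProjective (q : R2n n → ℝ) (M : ℝ) : Prop where
  continuousOn : ContinuousOn q {0}ᶜ
  bound : ∀ x, |q x| ≤ M
  invariant : ∀ (c : ℂ) (x : R2n n), c ≠ 0 → q (cmul c x) = q x

lemma IsProjective.measurable {q : R2n n → ℝ} {M : ℝ} (hq : IsProjective q M) : Measurable q :=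
  measurable_of_continuousOn_compl_singleton 0 hq.continuousOn

lemma IsProjective.bound_nonneg {q : R2n n → ℝ} {M : ℝ} (hq : IsProjective q M) : 0 ≤ M :=
  (abs_nonneg _).trans (hq.bound 0)

/-- The homogeneous extension of degree `-2n+2`. -/
def homogeneous (q : R2n n → ℝ) (x : R2n n) : ℝ := q x * ‖x‖ ^ (-2 * (n : ℤ) + 2)

lemma IsProjective.measurable_homogeneous {q : R2n n → ℝ} {M : ℝ} (hq : IsProjective q M) :
    Measurable (homogeneous q) := by
  refine hq.measurable.mul ?_
  refine measurable_of_continuousOn_compl_singleton 0 ?_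
  exact continuous_norm.continuousOn.zpow₀ _ fun x hx => Or.inl (norm_ne_zero_iff.2 hx)

lemma IsProjective.norm_homogeneous_le {q : R2n n → ℝ} {M : ℝ} (hq : IsProjective q M)
    (x : R2n n) : ‖(homogeneous q x : ℂ)‖ ≤ M * ‖x‖ ^ (-(2 * (n : ℝ) - 2)) := by
  have : (-(2 * (n : ℝ) - 2)) = ((-2 * (n : ℤ) + 2 : ℤ) : ℝ) := by push_cast; ring
  rw [this, Real.rpow_intCast, norm_real, homogeneous, norm_mul, norm_zpow, norm_norm]
  exact mul_le_mul_of_nonneg_right (hq.bound x) (by positivity)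

lemma homogeneous_eq {q : R2n n → ℝ} {x : R2n n} (hx : x ≠ 0) :
    homogeneous q x = q x * ‖x‖ ^ 2 * (‖x‖ ^ (2 * n))⁻¹ := by
  have hx' : ‖x‖ ≠ 0 := norm_ne_zero_iff.2 hx
  rw [homogeneous, zpow_add₀ hx', neg_mul, zpow_neg]
  norm_cast
  ring

/-- The Gaussian regularization of the Fourier transform of `homogeneous q`. -/
def gaussReg (q : R2n n → ℝ) (ε : ℝ) (y : R2n n) : ℝ :=
  2 * n / ε * ∫ x, (closedBall (0 : R2n n) 1).indicator
    (fun x => q x * Real.exp (-‖hdot x y‖ ^ 2 / (2 * ε * ‖x‖ ^ 2))) x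

lemma integrable_damped (ε : ℝ) (hε : 0 < ε) (y : R2n n) : Integrable (dampedExp ε y) := by
  have hb : 0 < (((ε / 2 : ℝ)) : ℂ).re := by rw [ofReal_re]; positivity
  refine (GaussianFourier.integrable_cexp_neg_mul_sq_norm_add hb (-I) y).congr
    (.of_forall fun x => ?_)
  simp only
  rw [dampedExp, real_inner_comm]
  congr 1
  push_cast; ring

lemma norm_dampedExp_le_one {ε : ℝ} (hε : 0 < ε) (y x : R2n n) : ‖dampedExp ε y x‖ ≤ 1 := by
  rw [norm_dampedExp, Real.exp_le_one_iff]
  have : 0 ≤ ε / 2 * ‖x‖ ^ 2 := by positivity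
  linarith

lemma IsProjective.integrable_homogeneous_mul {q : R2n n → ℝ} {M : ℝ} (hq : IsProjective q M)
    (hn : 2 ≤ n) {B : R2n n → ℂ} {D : ℝ} (hB : Integrable B) (hBD : ∀ x, ‖B x‖ ≤ D) :
    Integrable fun x => (homogeneous q x : ℂ) * B x := by
  have hn' : (2 : ℝ) ≤ n := by exact_mod_cast hn
  refine integrable_mul_of_norm_le_rpow (α := 2 * (n : ℝ) - 2) (by rw [finrank_R2n]; omega)
    (by linarith) (by rw [finrank_R2n]; push_cast; linarith)
    (fun x _ => hq.norm_homogeneous_le x)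
    (measurable_ofReal.comp hq.measurable_homogeneous).aestronglyMeasurable hB hBD

/-- Integrand of the double integral over `ℂ × ℂⁿ`. -/
def lineKernel (q : R2n n → ℝ) (ε : ℝ) (y : R2n n) (p : ℂ × R2n n) : ℂ :=
  ((closedBall (0 : R2n n) 1).indicator (fun x => q x * ‖x‖ ^ 2) p.2 : ℝ) *
    dampedExp ε y (cmul p.1 p.2)

/-- The kernel `lineKernel` after the substitution `x ↦ c⁻¹ x`. -/
def tailKernel (q : R2n n → ℝ) (ε : ℝ) (y : R2n n) (p : ℂ × R2n n) : ℂ :=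
  (q p.2 * ‖p.2‖ ^ 2 : ℝ) * dampedExp ε y p.2 * tailWeight n ‖p.2‖ p.1

/-- The weight |x|² cancels the |x|⁻² coming from the absolute integral over the complex line,
leaving a bounded function on the unit ball. -/
lemma IsProjective.integrable_lineKernel {q : R2n n → ℝ} {M : ℝ} (hq : IsProjective q M)
    (hn : 2 ≤ n) {ε : ℝ} (hε : 0 < ε) (y : R2n n) :
    Integrable (lineKernel q ε y) (volume.prod volume) := by
  have : Nontrivial (R2n n) :=
    Module.nontrivial_of_finrank_pos (R := ℝ) (by rw [finrank_R2n]; omega)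
  have hm : Measurable (lineKernel q ε y) := by
    have h1 : Measurable fun x : R2n n =>
        (closedBall (0 : R2n n) 1).indicator (fun x => q x * ‖x‖ ^ 2) x :=
      (hq.measurable.mul (by fun_prop)).indicator measurableSet_closedBall
    exact (measurable_ofReal.comp (h1.comp measurable_snd)).mul
      ((continuous_dampedExp ε y).comp continuous_cmul).measurable
  refine (integrable_prod_iff' hm.aestronglyMeasurable).2 ⟨?_, ?_⟩
  · filter_upwards [Measure.ae_ne volume (0 : R2n n)] with x hx
    simp only [lineKernel]
    exact (integrable_dampedExp_line hε y hx).const_mul _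
  · have hb : Integrable ((closedBall (0 : R2n n) 1).indicator
        (fun x => |q x| * (2 * Real.pi / ε))) := by
      rw [integrable_indicator_iff measurableSet_closedBall]
      refine Integrable.mul_const ?_ _
      refine Measure.integrableOn_of_bounded (M := M) measure_closedBall_lt_top.ne
        (by have := hq.measurable; fun_prop) (.of_forall fun x => ?_)
      simpa using hq.bound x
    refine hb.congr ?_
    filter_upwards [Measure.ae_ne volume (0 : R2n n)] with x hx
    have hx' : ‖x‖ ≠ 0 := norm_ne_zero_iff.2 hx
    simp only [lineKernel, norm_mul]
    rw [integral_const_mul, integral_norm_dampedExp_line hε y hx]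
    by_cases h1 : x ∈ closedBall (0 : R2n n) 1
    · rw [indicator_of_mem h1, indicator_of_mem h1, norm_real, norm_mul, norm_pow, norm_norm,
        Real.norm_eq_abs]
      field_simp
    · rw [indicator_of_notMem h1, indicator_of_notMem h1]; simp

/-- Integrating out c restores, up to π/n, the homogeneous function times a Gaussian; this is
integrable because its singularity has order 2n-2 < 2n. -/
lemma IsProjective.integrable_tailKernel {q : R2n n → ℝ} {M : ℝ} (hq : IsProjective q M)
    (hn : 2 ≤ n) {ε : ℝ} (hε : 0 < ε) (y : R2n n) :
    Integrable (tailKernel q ε y) (volume.prod volume) := by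
  have : Nontrivial (R2n n) :=
    Module.nontrivial_of_finrank_pos (R := ℝ) (by rw [finrank_R2n]; omega)
  have hm : Measurable (tailKernel q ε y) := by
    have h1 : Measurable fun x : R2n n => ((q x * ‖x‖ ^ 2 : ℝ) : ℂ) * dampedExp ε y x :=
      (measurable_ofReal.comp (hq.measurable.mul (by fun_prop))).mul
        (continuous_dampedExp ε y).measurable
    refine (h1.comp measurable_snd).mul (measurable_ofReal.comp ?_)
    have h2 : (fun p : ℂ × R2n n => tailWeight n ‖p.2‖ p.1) =
        indicator {p : ℂ × R2n n | ‖p.2‖ ≤ ‖p.1‖} fun p => (‖p.1‖ ^ (2 * n + 2))⁻¹ := rfl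
    rw [h2]
    exact Measurable.indicator (by fun_prop) (measurableSet_le (by fun_prop) (by fun_prop))
  refine (integrable_prod_iff' hm.aestronglyMeasurable).2 ⟨?_, ?_⟩
  · filter_upwards [Measure.ae_ne volume (0 : R2n n)] with x hx
    simp only [tailKernel]
    exact ((integrable_tailWeight (n := n) (by omega) (norm_pos_iff.2 hx)).ofReal
      (𝕜 := ℂ)).const_mul _
  · refine (((hq.integrable_homogeneous_mul hn (integrable_damped ε hε y)
      (norm_dampedExp_le_one hε y)).norm).mul_const (Real.pi / n)).congr ?_
    filter_upwards [Measure.ae_ne volume (0 : R2n n)] with x hx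
    have hx' : 0 < ‖x‖ := norm_pos_iff.2 hx
    simp only [tailKernel, norm_mul, norm_real]
    rw [integral_const_mul]
    simp_rw [Real.norm_of_nonneg (tailWeight_nonneg n ‖x‖ _)]
    rw [integral_tailWeight (by omega) hx', homogeneous_eq hx]
    simp only [norm_mul, norm_inv, norm_pow, norm_norm]
    ring

lemma IsProjective.integral_lineKernel_eq {q : R2n n → ℝ} {M : ℝ} (hq : IsProjective q M)
    (ε : ℝ) (y : R2n n) {c : ℂ} (hc : c ≠ 0) :
    ∫ x, lineKernel q ε y (c, x) = ∫ x, tailKernel q ε y (c, x) := by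
  have hc' : 0 < ‖c‖ := norm_pos_iff.2 hc
  -- After the substitution the ball has radius ‖c‖ and |x|² yields ‖c‖⁻²; together with the
  -- Jacobian ‖c‖^{-2n} this is the power in `tailWeight`.
  set G : R2n n → ℂ := fun x => ((closedBall (0 : R2n n) ‖c‖).indicator
    (fun x => q x * ‖x‖ ^ 2 * (‖c‖ ^ 2)⁻¹) x : ℝ) * dampedExp ε y x with hG
  have h1 : ∀ x, lineKernel q ε y (c, x) = G (cmul c x) := fun x => by
    simp only [lineKernel, hG]
    congr 2
    by_cases hx : ‖x‖ ≤ 1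
    · rw [indicator_of_mem (by simpa using hx), indicator_of_mem, hq.invariant c x hc, norm_cmul]
      · field_simp
      · rw [mem_closedBall_zero_iff, norm_cmul]; exact mul_le_of_le_one_right hc'.le hx
    · rw [indicator_of_notMem (by simpa using hx), indicator_of_notMem]
      rw [mem_closedBall_zero_iff, norm_cmul, mul_le_iff_le_one_right hc']; exact hx
  simp_rw [h1]
  rw [integral_comp_cmul G hc, ← integral_smul]
  refine integral_congr_ae (.of_forall fun x => ?_)
  simp only [hG, tailKernel, tailWeight]
  by_cases hx : ‖x‖ ≤ ‖c‖
  · rw [indicator_of_mem (by simpa using hx), indicator_of_mem (by simpa using hx), real_smul]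
    push_cast
    ring
  · rw [indicator_of_notMem (by simpa using hx), indicator_of_notMem (by simpa using hx)]
    simp

/-- The Fourier transform of the damped homogeneous function in closed form. -/
lemma IsProjective.integral_homogeneous_mul_dampedExp {q : R2n n → ℝ} {M : ℝ}
    (hq : IsProjective q M) (hn : 2 ≤ n) {ε : ℝ} (hε : 0 < ε) (y : R2n n) :
    ∫ x, (homogeneous q x : ℂ) * dampedExp ε y x = gaussReg q ε y := by
  have : Nontrivial (R2n n) :=
    Module.nontrivial_of_finrank_pos (R := ℝ) (by rw [finrank_R2n]; omega)
  have hnc : (n : ℂ) ≠ 0 := by norm_cast; omega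
  have hpi : (Real.pi : ℂ) ≠ 0 := by exact_mod_cast Real.pi_ne_zero
  have hεc : (ε : ℂ) ≠ 0 := by exact_mod_cast hε.ne'
  have h1 := integral_integral_swap (f := fun c x => lineKernel q ε y (c, x))
    (hq.integrable_lineKernel hn hε y)
  have h2 := integral_integral_swap (f := fun c x => tailKernel q ε y (c, x))
    (hq.integrable_tailKernel hn hε y)
  have h3 : ∫ c, ∫ x, lineKernel q ε y (c, x) = ∫ c, ∫ x, tailKernel q ε y (c, x) := by
    refine integral_congr_ae ?_
    filter_upwards [Measure.ae_ne volume (0 : ℂ)] with c hc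
    exact hq.integral_lineKernel_eq ε y hc
  have h4 : ∫ x, ∫ c, tailKernel q ε y (c, x) =
      (Real.pi / n : ℂ) * ∫ x, (homogeneous q x : ℂ) * dampedExp ε y x := by
    rw [← integral_const_mul]
    refine integral_congr_ae ?_
    filter_upwards [Measure.ae_ne volume (0 : R2n n)] with x hx
    simp only [tailKernel]
    rw [integral_const_mul, integral_complex_ofReal, integral_tailWeight (by omega) (norm_pos_iff.2 hx),
      homogeneous_eq hx]
    push_cast
    ring
  have h5 : ∫ x, ∫ c, lineKernel q ε y (c, x) = (2 * Real.pi / ε : ℂ) *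
      ((∫ x, (closedBall (0 : R2n n) 1).indicator
        (fun x => q x * Real.exp (-‖hdot x y‖ ^ 2 / (2 * ε * ‖x‖ ^ 2))) x : ℝ) : ℂ) := by
    rw [← integral_complex_ofReal, ← integral_const_mul]
    refine integral_congr_ae ?_
    filter_upwards [Measure.ae_ne volume (0 : R2n n)] with x hx
    have hxc : (‖x‖ : ℂ) ≠ 0 := by exact_mod_cast norm_ne_zero_iff.2 hx
    simp only [lineKernel]
    rw [integral_const_mul, integral_dampedExp_line hε y hx]
    by_cases h1 : x ∈ closedBall (0 : R2n n) 1
    · rw [indicator_of_mem h1, indicator_of_mem h1]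
      push_cast
      field_simp
    · rw [indicator_of_notMem h1, indicator_of_notMem h1]; simp
  -- Both sides compute the same double integral: Fubini for each kernel, joined by the substitution
  -- at fixed c ≠ 0.
  have h6 : (Real.pi / n : ℂ) * ∫ x, (homogeneous q x : ℂ) * dampedExp ε y x =
      (2 * Real.pi / ε : ℂ) * ((∫ x, (closedBall (0 : R2n n) 1).indicator
        (fun x => q x * Real.exp (-‖hdot x y‖ ^ 2 / (2 * ε * ‖x‖ ^ 2))) x : ℝ) : ℂ) := by
    rw [← h4, ← h5, ← h2, ← h1, h3]
  have h7 : (Real.pi / n : ℂ) ≠ 0 := div_ne_zero hpi hnc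
  refine mul_left_cancel₀ h7 (h6.trans ?_)
  rw [gaussReg]
  push_cast
  field_simp

/-! ### Concentration on the hyperplane as ε → 0. -/

/-- Oblique coordinates `H_e × ℂ → ℂⁿ` adapted to the functional `hdot · y`. -/
def shearPoint (e y : R2n n) (s : ℝ) (p : hyperplane e × ℂ) : R2n n :=
  (p.1 : R2n n) + cmul (s • p.2 - hdot p.1 y / hdot e y) e

/-- The integrand of `gaussReg` in oblique coordinates, rescaled along the complex line. -/
def shearKernel (q : R2n n → ℝ) (e y : R2n n) (s : ℝ) (p : hyperplane e × ℂ) : ℝ :=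
  (closedBall (0 : R2n n) 1).indicator
    (fun x => q x * Real.exp (-(‖p.2‖ * ‖hdot e y‖) ^ 2 / (2 * ‖x‖ ^ 2))) (shearPoint e y s p)

/-- The integrable majorant of `shearKernel`. -/
def shearMajorant (e : R2n n) (M c : ℝ) (p : hyperplane e × ℂ) : ℝ :=
  (closedBall (0 : hyperplane e) 1).indicator (fun _ => M) p.1 * Real.exp (-(c / 2) * ‖p.2‖ ^ 2)

/-- The shear makes the form depend on the ℂ-coordinate alone, although e need not be parallel to y.
-/
lemma hdot_shearPoint {e y : R2n n} (hy : hdot e y ≠ 0) (s : ℝ) (p : hyperplane e × ℂ) :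
    hdot (shearPoint e y s p) y = s • p.2 * hdot e y := by
  rw [shearPoint, hdot_add_left, hdot_cmul_left, sub_mul, div_mul_cancel₀ _ hy]
  ring

lemma norm_fst_le_norm_add_cmul {e : R2n n} (he : ‖e‖ = 1) (u : hyperplane e) (w : ℂ) :
    ‖u‖ ≤ ‖(u : R2n n) + cmul w e‖ := by
  have h := (splitIsometry e he).norm_map (WithLp.toLp 2 (u, w))
  change ‖(u : R2n n) + cmul w e‖ = _ at h
  rw [h]
  refine (sq_le_sq₀ (norm_nonneg _) (norm_nonneg _)).1 ?_
  rw [WithLp.prod_norm_sq_eq_of_L2]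
  simp

lemma norm_fst_le_norm_shearPoint {e : R2n n} (he : ‖e‖ = 1) (y : R2n n) (s : ℝ)
    (p : hyperplane e × ℂ) : ‖p.1‖ ≤ ‖shearPoint e y s p‖ :=
  norm_fst_le_norm_add_cmul he _ _

lemma continuous_shearPoint (e y : R2n n) (s : ℝ) : Continuous (shearPoint e y s) := by
  unfold shearPoint
  refine Continuous.add (by fun_prop) ?_
  refine continuous_cmul.comp (Continuous.prodMk ?_ continuous_const)
  refine Continuous.sub (by fun_prop) (Continuous.div_const ?_ _)
  exact continuous_hdot.comp (Continuous.prodMk (by fun_prop) continuous_const)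

lemma IsProjective.measurable_shearKernel {q : R2n n → ℝ} {M : ℝ} (hq : IsProjective q M)
    (e y : R2n n) (s : ℝ) : Measurable (shearKernel q e y s) := by
  have h1 := (continuous_shearPoint e y s).measurable
  have h2 := hq.measurable.comp h1
  change Measurable ((shearPoint e y s ⁻¹' closedBall 0 1).indicator fun p =>
    q (shearPoint e y s p) *
      Real.exp (-(‖p.2‖ * ‖hdot e y‖) ^ 2 / (2 * ‖shearPoint e y s p‖ ^ 2)))
  refine Measurable.indicator (h2.mul ?_) (h1 measurableSet_closedBall)
  fun_prop

lemma integrable_shearMajorant (e : R2n n) (M : ℝ) {c : ℝ} (hc : 0 < c) :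
    Integrable (shearMajorant e M c) (volume.prod volume) := by
  have h1 : Integrable ((closedBall (0 : hyperplane e) 1).indicator fun _ => M) :=
    (integrable_indicator_iff measurableSet_closedBall).2
      (integrableOn_const measure_closedBall_lt_top.ne)
  have h2 : Integrable fun z : ℂ => Real.exp (-(c / 2) * ‖z‖ ^ 2) := by
    have hb : 0 < (((c / 2 : ℝ)) : ℂ).re := by rw [ofReal_re]; positivity
    refine (GaussianFourier.integrable_cexp_neg_mul_sq_norm_add hb 0 (0 : ℂ)).norm.congr
      (.of_forall fun z => ?_)
    simp only [norm_exp]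
    congr 1
    simp [← ofReal_pow]
  exact h1.mul_prod h2

lemma integral_shearMajorant (e : R2n n) (M : ℝ) {c : ℝ} (hc : 0 < c) :
    ∫ p, shearMajorant e M c p ∂(volume.prod volume) =
      M * volume.real (closedBall (0 : hyperplane e) 1) * (2 * Real.pi / c) := by
  unfold shearMajorant
  rw [integral_prod_mul (f := (closedBall (0 : hyperplane e) 1).indicator fun _ => M)
    (g := fun z : ℂ => Real.exp (-(c / 2) * ‖z‖ ^ 2)),
    GaussianFourier.integral_rexp_neg_mul_sq_norm (by positivity), finrank_real_complex,
    integral_indicator measurableSet_closedBall]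
  norm_num
  field_simp

lemma ae_fst_ne_zero {e : R2n n} (he : ‖e‖ = 1) (hn : 2 ≤ n) :
    ∀ᵐ p : hyperplane e × ℂ ∂(volume.prod volume), p.1 ≠ 0 := by
  have : Nontrivial (hyperplane e) := Module.nontrivial_of_finrank_pos (R := ℝ)
    (by rw [finrank_hyperplane_of_norm_one e he]; omega)
  exact Measure.quasiMeasurePreserving_fst.ae (Measure.ae_ne volume (0 : hyperplane e))

/-- On the support |x| ≤ 1, so dividing the exponent by |x|² only strengthens the decay, and the
orthogonal component u satisfies |u| ≤ |x| ≤ 1. The condition u ≠ 0 keeps x ≠ 0 in the denominator.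
The majorant does not involve s, and y enters only through c. -/
lemma IsProjective.norm_shearKernel_le {q : R2n n → ℝ} {M : ℝ} (hq : IsProjective q M)
    {e : R2n n} (he : ‖e‖ = 1) (y : R2n n) (s : ℝ) {c : ℝ} (hcy : c ≤ ‖hdot e y‖ ^ 2)
    {p : hyperplane e × ℂ} (hp : p.1 ≠ 0) :
    ‖shearKernel q e y s p‖ ≤ shearMajorant e M c p := by
  have hM := hq.bound_nonneg
  have hle := norm_fst_le_norm_shearPoint he y s p
  have hp0 : 0 < ‖shearPoint e y s p‖ := (norm_pos_iff.2 hp).trans_le hle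
  unfold shearKernel shearMajorant
  by_cases h : ‖shearPoint e y s p‖ ≤ 1
  · rw [indicator_of_mem (by simpa using h), indicator_of_mem (by simpa using hle.trans h),
      norm_mul, Real.norm_of_nonneg (Real.exp_nonneg _)]
    refine mul_le_mul (hq.bound _) (Real.exp_le_exp.2 ?_) (Real.exp_nonneg _) hM
    rw [neg_div, neg_mul, neg_le_neg_iff, le_div_iff₀ (by positivity)]
    have h2 : ‖shearPoint e y s p‖ ^ 2 ≤ 1 := pow_le_one₀ hp0.le h
    calc c / 2 * ‖p.2‖ ^ 2 * (2 * ‖shearPoint e y s p‖ ^ 2)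
        = c * (‖p.2‖ ^ 2 * ‖shearPoint e y s p‖ ^ 2) := by ring
      _ ≤ ‖hdot e y‖ ^ 2 * (‖p.2‖ ^ 2 * ‖shearPoint e y s p‖ ^ 2) :=
          mul_le_mul_of_nonneg_right hcy (by positivity)
      _ ≤ ‖hdot e y‖ ^ 2 * (‖p.2‖ ^ 2 * 1) := by gcongr
      _ = (‖p.2‖ * ‖hdot e y‖) ^ 2 := by ring
  · rw [indicator_of_notMem (by simpa using h), norm_zero]
    exact mul_nonneg (indicator_apply_nonneg fun _ => hM) (Real.exp_nonneg _)

lemma IsProjective.integrable_shearKernel {q : R2n n → ℝ} {M : ℝ} (hq : IsProjective q M)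
    (hn : 2 ≤ n) {e y : R2n n} (he : ‖e‖ = 1) (hy : hdot e y ≠ 0) (s : ℝ) :
    Integrable (shearKernel q e y s) (volume.prod volume) := by
  refine (integrable_shearMajorant e M (c := ‖hdot e y‖ ^ 2)
    (pow_pos (norm_pos_iff.2 hy) 2)).mono'
    (hq.measurable_shearKernel e y s).aestronglyMeasurable ?_
  filter_upwards [ae_fst_ne_zero he hn] with p hp
  exact hq.norm_shearKernel_le he y s le_rfl hp

lemma IsProjective.gaussReg_eq {q : R2n n → ℝ} {M : ℝ} (hq : IsProjective q M)
    (hn : 2 ≤ n) {e y : R2n n} (he : ‖e‖ = 1) (hy : hdot e y ≠ 0) {ε : ℝ} (hε : 0 < ε) :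
    gaussReg q ε y = 2 * n * ∫ p, shearKernel q e y (Real.sqrt ε) p ∂(volume.prod volume) := by
  have hs : 0 < Real.sqrt ε := Real.sqrt_pos.2 hε
  have hs2 : Real.sqrt ε ^ 2 = ε := Real.sq_sqrt hε.le
  set K : R2n n → ℝ := (closedBall (0 : R2n n) 1).indicator
    (fun x => q x * Real.exp (-‖hdot x y‖ ^ 2 / (2 * ε * ‖x‖ ^ 2))) with hK
  have hKint : Integrable K := by
    rw [hK, integrable_indicator_iff measurableSet_closedBall]
    have hm : Measurable fun x : R2n n =>
        q x * Real.exp (-‖hdot x y‖ ^ 2 / (2 * ε * ‖x‖ ^ 2)) := by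
      have h1 : Continuous fun x : R2n n => hdot x y :=
        continuous_hdot.comp (Continuous.prodMk continuous_id continuous_const)
      have h2 := h1.measurable
      exact hq.measurable.mul (by fun_prop)
    refine Measure.integrableOn_of_bounded (M := M) measure_closedBall_lt_top.ne
      hm.aestronglyMeasurable (.of_forall fun x => ?_)
    rw [norm_mul, Real.norm_of_nonneg (Real.exp_nonneg _)]
    refine (mul_le_of_le_one_right (norm_nonneg _) (Real.exp_le_one_iff.2 ?_)).trans (hq.bound x)
    rw [neg_div]
    exact neg_nonpos.2 (by positivity)
  have hK2 : Integrable (fun p : hyperplane e × ℂ => K ((p.1 : R2n n) + cmul p.2 e))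
      (volume.prod volume) :=
    ((measurePreserving_split e he).integrable_comp_emb (measurableEmbedding_split e he)).2 hKint
  have h1 : ∫ x, K x = ∫ p : hyperplane e × ℂ, K ((p.1 : R2n n) + cmul p.2 e)
      ∂(volume.prod volume) :=
    ((measurePreserving_split e he).integral_comp (measurableEmbedding_split e he) K).symm
  have h2 : ∀ (u : hyperplane e) (z : ℂ), K (shearPoint e y (Real.sqrt ε) (u, z)) =
      shearKernel q e y (Real.sqrt ε) (u, z) := fun u z => by
    simp only [hK, shearKernel]
    by_cases h : shearPoint e y (Real.sqrt ε) (u, z) ∈ closedBall 0 1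
    · rw [indicator_of_mem h, indicator_of_mem h, hdot_shearPoint hy, norm_mul, norm_smul,
        Real.norm_of_nonneg hs.le]
      congr 2
      rw [mul_assoc, mul_pow, hs2]
      field_simp
    · rw [indicator_of_notMem h, indicator_of_notMem h]
  have h3 : ∀ u : hyperplane e, ∫ z, K ((u : R2n n) + cmul z e) =
      ε * ∫ z, shearKernel q e y (Real.sqrt ε) (u, z) := fun u => by
    simp_rw [← h2, shearPoint]
    -- Scaling ℂ by √ε has Jacobian ε, which later cancels the 1/ε of `gaussReg`; the shear is a
    -- translation in z for fixed u.
    rw [Measure.integral_comp_smul volume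
      (fun z => K ((u : R2n n) + cmul (z - hdot (u : R2n n) y / hdot e y) e)),
      integral_sub_right_eq_self (fun z => K ((u : R2n n) + cmul z e)), finrank_real_complex, hs2,
      abs_of_nonneg (by positivity), smul_eq_mul, mul_inv_cancel_left₀ hε.ne']
  rw [gaussReg, h1, integral_prod _ hK2, integral_prod _ (hq.integrable_shearKernel hn he hy _)]
  simp_rw [h3]
  rw [integral_const_mul]
  field_simp

lemma complexRadon_smul (f : R2n n → ℝ) (y : R2n n) {c : ℝ} (hc : c ≠ 0) :
    complexRadon f (c • y) = complexRadon f y := by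
  have key : ∀ S T : Submodule ℝ (R2n n), S = T →
      ∫ θ : sphere (0 : S) 1, f ((θ : S) : R2n n) ∂(volume : Measure S).toSphere =
      ∫ θ : sphere (0 : T) 1, f ((θ : T) : R2n n) ∂(volume : Measure T).toSphere := by
    rintro S T rfl; rfl
  exact key _ _ (hyperplane_smul y hc)

/-- The limit of the regularized transforms. -/
def radonTransform (q : R2n n → ℝ) (y : R2n n) : ℝ := 2 * Real.pi / ‖y‖ ^ 2 * complexRadon q y

/-- At s = 0 and y = re the point is u itself, and the z-integral is a Gaussian of value 2π|u|²/r².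
What remains is the integral of q(u)|u|² over the unit ball of H_e. -/
lemma IsProjective.integral_shearKernel_zero {q : R2n n → ℝ} {M : ℝ} (hq : IsProjective q M)
    (hn : 2 ≤ n) {e : R2n n} (he : ‖e‖ = 1) {r : ℝ} (hr : 0 < r) :
    2 * n * ∫ p, shearKernel q e (r • e) 0 p ∂(volume.prod volume) =
      radonTransform q (r • e) := by
  have hfr := finrank_hyperplane_of_norm_one e he
  have : Nontrivial (hyperplane e) := Module.nontrivial_of_finrank_pos (R := ℝ)
    (by rw [hfr]; omega)
  have hre : hdot e (r • e) = r := by rw [hdot_smul_right, hdot_self, he]; simp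
  have hre0 : hdot e (r • e) ≠ 0 := by rw [hre]; exact_mod_cast hr.ne'
  have hnr : ‖r • e‖ = r := by rw [norm_smul, he, mul_one, Real.norm_of_nonneg hr.le]
  have hpt : ∀ p : hyperplane e × ℂ, shearPoint e (r • e) 0 p = p.1 := fun p => by
    rw [shearPoint, hdot_smul_right, mem_hyperplane.1 p.1.2]
    simp [zero_cmul]
  have hn0 : (n : ℝ) ≠ 0 := by norm_cast; omega
  rw [integral_prod _ (hq.integrable_shearKernel hn he hre0 0)]
  have h1 : ∀ u : hyperplane e, u ≠ 0 → ∫ z, shearKernel q e (r • e) 0 (u, z) =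
      2 * Real.pi / r ^ 2 * (closedBall (0 : hyperplane e) 1).indicator
        (fun u => q u * ‖u‖ ^ 2) u := fun u hu => by
    have hu' : 0 < ‖u‖ := norm_pos_iff.2 hu
    simp only [shearKernel, hpt]
    by_cases h : ‖u‖ ≤ 1
    · rw [indicator_of_mem (by simpa using h)]
      simp_rw [indicator_of_mem (show (u : R2n n) ∈ closedBall 0 1 by simpa using h)]
      rw [integral_const_mul, hre, norm_real, Real.norm_of_nonneg hr.le]
      have h2 : ∀ z : ℂ, -(‖z‖ * r) ^ 2 / (2 * ‖(u : R2n n)‖ ^ 2) =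
          -(r ^ 2 / (2 * ‖u‖ ^ 2)) * ‖z‖ ^ 2 := fun z => by
        rw [Submodule.coe_norm]; ring
      simp_rw [h2]
      rw [GaussianFourier.integral_rexp_neg_mul_sq_norm (by positivity), finrank_real_complex]
      norm_num
      field_simp
    · rw [indicator_of_notMem (by simpa using h)]
      simp_rw [indicator_of_notMem (show (u : R2n n) ∉ closedBall 0 1 by simpa using h)]
      simp
  have h2 : ∫ u : hyperplane e, ∫ z, shearKernel q e (r • e) 0 (u, z) =
      ∫ u : hyperplane e, 2 * Real.pi / r ^ 2 * (closedBall (0 : hyperplane e) 1).indicator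
        (fun u => q u * ‖u‖ ^ 2) u := by
    refine integral_congr_ae ?_
    filter_upwards [Measure.ae_ne volume (0 : hyperplane e)] with u hu
    exact h1 u hu
  rw [h2, integral_const_mul, integral_ball_mul_norm_sq volume (fun u : hyperplane e => q u)
    (hq.measurable.comp measurable_subtype_coe) (fun u => hq.bound u)
    (fun t u ht => by
      have := hq.invariant (t : ℂ) (u : R2n n) (by exact_mod_cast ht.ne')
      rwa [cmul_ofReal] at this), hfr, radonTransform, hnr, complexRadon_smul q e hr.ne']
  -- The denominator dim H_e + 2 = 2n cancels the prefactor 2n.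
  have h3 : (((2 * n - 2 : ℕ) : ℝ) + 2) = 2 * n := by
    rw [Nat.cast_sub (by omega)]; push_cast; ring
  rw [h3, complexRadon]
  field_simp

/-- The limit point is u: q is continuous there since u ≠ 0, and the indicator of the ball is
locally constant there since |u| ≠ 1. -/
lemma IsProjective.tendsto_shearKernel {q : R2n n → ℝ} {M : ℝ} (hq : IsProjective q M)
    {e : R2n n} (he : ‖e‖ = 1) {r : ℝ} (hr : 0 < r) {p : hyperplane e × ℂ} (hp : p.1 ≠ 0)
    (hp1 : ‖p.1‖ ≠ 1) :
    Tendsto (fun a : ℝ × R2n n => shearKernel q e a.2 (Real.sqrt a.1) p)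
      (𝓝 ((0 : ℝ), r • e)) (𝓝 (shearKernel q e (r • e) 0 p)) := by
  have hre : hdot e (r • e) = r := by rw [hdot_smul_right, hdot_self, he]; simp
  have hre0 : hdot e (r • e) ≠ 0 := by rw [hre]; exact_mod_cast hr.ne'
  have hpt : shearPoint e (r • e) 0 p = p.1 := by
    rw [shearPoint, hdot_smul_right, mem_hyperplane.1 p.1.2]
    simp [zero_cmul]
  have hd : ∀ v : R2n n, Continuous fun a : ℝ × R2n n => hdot v a.2 := fun v =>
    continuous_hdot.comp (Continuous.prodMk continuous_const continuous_snd)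
  have hx : Tendsto (fun a : ℝ × R2n n => shearPoint e a.2 (Real.sqrt a.1) p)
      (𝓝 ((0 : ℝ), r • e)) (𝓝 (p.1 : R2n n)) := by
    have hc : ContinuousAt (fun a : ℝ × R2n n => shearPoint e a.2 (Real.sqrt a.1) p)
        ((0 : ℝ), r • e) := by
      unfold shearPoint
      refine continuousAt_const.add ?_
      refine continuous_cmul.continuousAt.comp (ContinuousAt.prodMk ?_ continuousAt_const)
      refine ContinuousAt.sub (by fun_prop) ?_
      exact ((hd _).continuousAt).div ((hd e).continuousAt) hre0
    have := hc.tendsto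
    simpa [hpt] using this
  have hp' : (p.1 : R2n n) ≠ 0 := by simpa using hp
  unfold shearKernel
  rw [hpt]
  rcases lt_or_gt_of_ne hp1 with h | h
  · have hmem : ∀ᶠ a : ℝ × R2n n in 𝓝 ((0 : ℝ), r • e),
        shearPoint e a.2 (Real.sqrt a.1) p ∈ closedBall (0 : R2n n) 1 :=
      hx.eventually (closedBall_mem_nhds_of_mem (by simpa using h))
    rw [indicator_of_mem (by simpa using h.le)]
    refine Tendsto.congr' (f₁ := fun a : ℝ × R2n n => q (shearPoint e a.2 (Real.sqrt a.1) p) *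
      Real.exp (-(‖p.2‖ * ‖hdot e a.2‖) ^ 2 /
        (2 * ‖shearPoint e a.2 (Real.sqrt a.1) p‖ ^ 2))) ?_ ?_
    · filter_upwards [hmem] with a ha
      rw [indicator_of_mem ha]
    · have hqc : ContinuousAt q (p.1 : R2n n) :=
        hq.continuousOn.continuousAt (isOpen_compl_singleton.mem_nhds hp')
      refine (hqc.tendsto.comp hx).mul ((Real.continuous_exp.tendsto _).comp ?_)
      refine Tendsto.div ?_ ((hx.norm.pow 2).const_mul 2) ?_
      · exact (((((hd e).tendsto _).norm).const_mul _).pow 2).neg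
      · have : 0 < ‖(p.1 : R2n n)‖ := norm_pos_iff.2 hp'
        positivity
  · have hnmem : ∀ᶠ a : ℝ × R2n n in 𝓝 ((0 : ℝ), r • e),
        shearPoint e a.2 (Real.sqrt a.1) p ∉ closedBall (0 : R2n n) 1 :=
      hx.eventually (isClosed_closedBall.isOpen_compl.mem_nhds (by simpa using h))
    rw [indicator_of_notMem (by simpa using h)]
    refine tendsto_const_nhds.congr' ?_
    filter_upwards [hnmem] with a ha
    rw [indicator_of_notMem ha]

lemma IsProjective.tendsto_gaussReg {q : R2n n → ℝ} {M : ℝ} (hq : IsProjective q M)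
    (hn : 2 ≤ n) {y₀ : R2n n} (hy₀ : y₀ ≠ 0) :
    Tendsto (fun a : ℝ × R2n n => gaussReg q a.1 a.2) (𝓝[>] (0 : ℝ) ×ˢ 𝓝 y₀)
      (𝓝 (radonTransform q y₀)) := by
  -- The direction e of y₀ stays fixed while y varies, so all integrals live on the same space H_e ×
  -- ℂ.
  obtain ⟨e, r, he, hr, rfl⟩ : ∃ (e : R2n n) (r : ℝ), ‖e‖ = 1 ∧ 0 < r ∧ y₀ = r • e :=
    ⟨‖y₀‖⁻¹ • y₀, ‖y₀‖, norm_smul_inv_norm hy₀, norm_pos_iff.2 hy₀,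
      (smul_inv_smul₀ (norm_ne_zero_iff.2 hy₀) _).symm⟩
  have hfr := finrank_hyperplane_of_norm_one e he
  have hle : 𝓝[>] (0 : ℝ) ×ˢ 𝓝 (r • e) ≤ 𝓝 ((0 : ℝ), r • e) := by
    rw [nhds_prod_eq]; exact prod_mono nhdsWithin_le_nhds le_rfl
  have hpos : ∀ᶠ a : ℝ × R2n n in 𝓝[>] (0 : ℝ) ×ˢ 𝓝 (r • e), 0 < a.1 :=
    tendsto_fst.eventually self_mem_nhdsWithin
  have hre : hdot e (r • e) = r := by rw [hdot_smul_right, hdot_self, he]; simp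
  -- This lower bound gives one majorant for all nearby y and keeps the oblique coordinates
  -- nondegenerate.
  have hbig : ∀ᶠ a : ℝ × R2n n in 𝓝[>] (0 : ℝ) ×ˢ 𝓝 (r • e), r ^ 2 / 2 ≤ ‖hdot e a.2‖ ^ 2 := by
    have hc : Continuous fun a : ℝ × R2n n => ‖hdot e a.2‖ ^ 2 :=
      ((continuous_hdot.comp (Continuous.prodMk continuous_const continuous_snd)).norm).pow 2
    have h1 := (hc.tendsto ((0 : ℝ), r • e)).mono_left hle
    simp only [hre, norm_real, Real.norm_of_nonneg hr.le] at h1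
    exact h1.eventually_const_le (half_lt_self (by positivity))
  rw [← hq.integral_shearKernel_zero hn he hr]
  have hlim : Tendsto (fun a : ℝ × R2n n => 2 * (n : ℝ) *
      ∫ p, shearKernel q e a.2 (Real.sqrt a.1) p ∂(volume.prod volume))
      (𝓝[>] (0 : ℝ) ×ˢ 𝓝 (r • e))
      (𝓝 (2 * n * ∫ p, shearKernel q e (r • e) 0 p ∂(volume.prod volume))) := by
    refine Tendsto.const_mul _ ?_
    refine tendsto_integral_filter_of_dominated_convergence (shearMajorant e M (r ^ 2 / 2))
      (.of_forall fun a => (hq.measurable_shearKernel e a.2 _).aestronglyMeasurable) ?_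
      (integrable_shearMajorant e M (by positivity)) ?_
    · filter_upwards [hbig] with a ha
      filter_upwards [ae_fst_ne_zero he hn] with p hp
      exact hq.norm_shearKernel_le he _ _ ha hp
    · have hs : ∀ᵐ p : hyperplane e × ℂ ∂(volume.prod volume), ‖p.1‖ ≠ 1 := by
        have h0 : ∀ᵐ u : hyperplane e, ‖u‖ ≠ 1 := by
          have := Measure.addHaar_sphere_of_ne_zero (volume : Measure (hyperplane e)) 0
            (one_ne_zero (α := ℝ))
          rw [ae_iff]
          convert this using 2
          ext u; simp
        exact Measure.quasiMeasurePreserving_fst.ae h0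
      filter_upwards [ae_fst_ne_zero he hn, hs] with p hp hp1
      exact (hq.tendsto_shearKernel he hr hp hp1).mono_left hle
  refine hlim.congr' ?_
  filter_upwards [hpos, hbig] with a ha hab
  refine (hq.gaussReg_eq hn he ?_ ha).symm
  intro h0
  rw [h0, norm_zero] at hab
  have : 0 < r ^ 2 := by positivity
  norm_num at hab
  linarith

lemma IsProjective.tendsto_gaussReg_zero {q : R2n n → ℝ} {M : ℝ} (hq : IsProjective q M)
    (hn : 2 ≤ n) {y : R2n n} (hy : y ≠ 0) :
    Tendsto (fun ε => gaussReg q ε y) (𝓝[>] (0 : ℝ)) (𝓝 (radonTransform q y)) :=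
  (hq.tendsto_gaussReg hn hy).comp (tendsto_id.prodMk tendsto_const_nhds)

/-- Follows from the joint limit: in an estimate valid for small ε and y near y₀, let ε → 0 with y
fixed. -/
lemma IsProjective.continuousOn_radonTransform {q : R2n n → ℝ} {M : ℝ} (hq : IsProjective q M)
    (hn : 2 ≤ n) : ContinuousOn (radonTransform q) {0}ᶜ := by
  intro y₀ hy₀
  refine ContinuousAt.continuousWithinAt ?_
  refine Metric.tendsto_nhds.2 fun δ hδ => ?_
  have h1 := Metric.tendsto_nhds.1 (hq.tendsto_gaussReg hn hy₀) (δ / 2) (half_pos hδ)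
  obtain ⟨P, hP, Q, hQ, hPQ⟩ := eventually_prod_iff.1 h1
  filter_upwards [hQ, isOpen_compl_singleton.mem_nhds hy₀] with y hy hy0
  have h2 : dist (radonTransform q y) (radonTransform q y₀) ≤ δ / 2 := by
    refine le_of_tendsto ((hq.tendsto_gaussReg_zero hn hy0).dist tendsto_const_nhds) ?_
    filter_upwards [hP] with ε hε
    exact (hPQ hε hy).le
  linarith

lemma IsProjective.exists_bound_gaussReg {q : R2n n → ℝ} {M : ℝ} (hq : IsProjective q M)
    (hn : 2 ≤ n) : ∃ C : ℝ, ∀ (ε : ℝ) (y : R2n n), 0 < ε → y ≠ 0 →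
      |gaussReg q ε y| ≤ C * ‖y‖ ^ (-2 : ℝ) := by
  -- The volume of the unit ball in dimension 2n-2, written out so that the constant does not depend
  -- on e, which now varies with y.
  set v : ℝ := (ENNReal.ofReal (Real.sqrt Real.pi ^ (2 * n - 2) /
    Real.Gamma ((2 * n - 2 : ℕ) / 2 + 1))).toReal with hv
  refine ⟨2 * n * (M * v * (2 * Real.pi)), fun ε y hε hy => ?_⟩
  have hy' : 0 < ‖y‖ := norm_pos_iff.2 hy
  set e : R2n n := ‖y‖⁻¹ • y with he_def
  have he : ‖e‖ = 1 := norm_smul_inv_norm hy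
  have hey : hdot e y = ‖y‖ := by
    rw [he_def, hdot_smul_left, hdot_self]
    have : (‖y‖ : ℂ) ≠ 0 := by exact_mod_cast hy'.ne'
    push_cast; field_simp
  have hfr := finrank_hyperplane_of_norm_one e he
  have : Nontrivial (hyperplane e) := Module.nontrivial_of_finrank_pos (R := ℝ)
    (by rw [hfr]; omega)
  have hvol : volume.real (closedBall (0 : hyperplane e) 1) = v := by
    rw [Measure.real, InnerProductSpace.volume_closedBall, hfr, hv]
    simp
  rw [hq.gaussReg_eq hn he (by rw [hey]; exact_mod_cast hy'.ne') hε, abs_mul,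
    abs_of_nonneg (by positivity : (0 : ℝ) ≤ 2 * n), mul_assoc (2 * (n : ℝ))]
  refine mul_le_mul_of_nonneg_left ?_ (by positivity)
  have hc : (0 : ℝ) < ‖y‖ ^ 2 := by positivity
  have h1 : |∫ p, shearKernel q e y (Real.sqrt ε) p ∂(volume.prod volume)| ≤
      ∫ p, shearMajorant e M (‖y‖ ^ 2) p ∂(volume.prod volume) := by
    rw [← Real.norm_eq_abs]
    refine norm_integral_le_of_norm_le (integrable_shearMajorant e M hc) ?_
    filter_upwards [ae_fst_ne_zero he hn] with p hp
    exact hq.norm_shearKernel_le he _ _ (by rw [hey]; simp) hp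
  refine h1.trans_eq ?_
  rw [integral_shearMajorant e M hc, hvol, Real.rpow_neg hy'.le]
  norm_num
  ring

lemma IsProjective.exists_bound_radonTransform {q : R2n n → ℝ} {M : ℝ} (hq : IsProjective q M)
    (hn : 2 ≤ n) : ∃ C : ℝ, (∀ (ε : ℝ) (y : R2n n), 0 < ε → y ≠ 0 →
      |gaussReg q ε y| ≤ C * ‖y‖ ^ (-2 : ℝ)) ∧
      ∀ y : R2n n, y ≠ 0 → |radonTransform q y| ≤ C * ‖y‖ ^ (-2 : ℝ) := by
  obtain ⟨C, hC⟩ := hq.exists_bound_gaussReg hn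
  refine ⟨C, hC, fun y hy => ?_⟩
  refine le_of_tendsto (hq.tendsto_gaussReg_zero hn hy).abs ?_
  filter_upwards [self_mem_nhdsWithin] with ε hε
  exact hC ε y hε hy

/-! ### Pairing with test functions. -/

open scoped FourierTransform in
lemma testFourier_eq (φ : SchwartzMap (R2n n) ℂ) (y : R2n n) :
    testFourier φ y = (𝓕 φ) ((2 * Real.pi)⁻¹ • y) := by
  rw [SchwartzMap.fourier_coe, Real.fourier_eq', testFourier]
  refine integral_congr_ae (.of_forall fun x => ?_)
  simp only [smul_eq_mul, inner_smul_right]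
  rw [mul_comm]
  congr 2
  have : (Real.pi : ℂ) ≠ 0 := by exact_mod_cast Real.pi_ne_zero
  push_cast
  field_simp

lemma integrable_testFourier (φ : SchwartzMap (R2n n) ℂ) : Integrable (testFourier φ) := by
  rw [funext (testFourier_eq φ)]
  exact (integrable_comp_smul_iff volume _ (inv_ne_zero (by positivity))).2
    (SchwartzMap.integrable _)

lemma exists_bound_schwartz (φ : SchwartzMap (R2n n) ℂ) : ∃ D, ∀ x, ‖φ x‖ ≤ D :=
  ⟨_, fun x => SchwartzMap.norm_le_seminorm ℝ φ x⟩

lemma exists_bound_testFourier (φ : SchwartzMap (R2n n) ℂ) : ∃ D, ∀ x, ‖testFourier φ x‖ ≤ D := by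
  simp_rw [testFourier_eq φ]
  exact (exists_bound_schwartz _).imp fun D hD x => hD _

lemma hasPowerGrowth_of_norm_le (hn : 1 ≤ n) {A : R2n n → ℂ} {C α : ℝ} (hα0 : 0 ≤ α)
    (hα : α < 2 * n) (hA : ∀ x, x ≠ 0 → ‖A x‖ ≤ C * ‖x‖ ^ (-α))
    (hAm : AEStronglyMeasurable A volume) : HasPowerGrowth A := by
  have : Nontrivial (R2n n) :=
    Module.nontrivial_of_finrank_pos (R := ℝ) (by rw [finrank_R2n]; omega)
  refine ⟨locallyIntegrable_of_norm_le_rpow (by rw [finrank_R2n]; omega)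
    (by rw [finrank_R2n]; push_cast; exact hα) (by
      filter_upwards [Measure.ae_ne volume (0 : R2n n)] with x hx using hA x hx) hAm,
    1, one_pos, ?_⟩
  have hC : 0 ≤ C := by
    obtain ⟨x, hx⟩ := exists_ne (0 : R2n n)
    exact nonneg_of_mul_nonneg_left ((norm_nonneg _).trans (hA x hx))
      (Real.rpow_pos_of_pos (norm_pos_iff.2 hx) _)
  have hlim : Tendsto (fun x : R2n n => C * ‖x‖⁻¹) (cocompact (R2n n)) (𝓝 0) := by
    have := (tendsto_inv_atTop_zero.comp (tendsto_norm_cocompact_atTop (E := R2n n))).const_mul C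
    simpa using this
  refine squeeze_zero_norm' ?_ hlim
  filter_upwards [(tendsto_norm_cocompact_atTop (E := R2n n)).eventually_ge_atTop 1] with x hx
  rw [norm_div, norm_real, Real.rpow_one, norm_norm, div_eq_mul_inv]
  refine mul_le_mul_of_nonneg_right ?_ (by positivity)
  refine (hA x (norm_pos_iff.1 (by linarith))).trans ?_
  exact mul_le_of_le_one_right hC (Real.rpow_le_one_of_one_le_of_nonpos hx (by linarith))

lemma dampedExp_eq (ε : ℝ) (y x : R2n n) :
    dampedExp ε y x = (Real.exp (-(ε / 2) * ‖x‖ ^ 2) : ℝ) * cexp (-I * (inner ℝ y x : ℝ)) := by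
  rw [dampedExp, ofReal_exp, ← Complex.exp_add, real_inner_comm]
  congr 1
  push_cast; ring

lemma IsProjective.integral_damped_mul_testFourier {q : R2n n → ℝ} {M : ℝ}
    (hq : IsProjective q M) (hn : 2 ≤ n) {ε : ℝ} (hε : 0 < ε) (φ : SchwartzMap (R2n n) ℂ) :
    ∫ x, (Real.exp (-(ε / 2) * ‖x‖ ^ 2) : ℝ) * ((homogeneous q x : ℂ) * testFourier φ x) =
      ∫ y, (gaussReg q ε y : ℂ) * φ y := by
  have hint : Integrable (fun p : R2n n × R2n n =>
      (homogeneous q p.1 : ℂ) * dampedExp ε p.2 p.1 * φ p.2) (volume.prod volume) := by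
    -- At y = 0 the phase disappears and the variables separate; the phase is then restored as a
    -- factor of modulus one.
    have h0 : Integrable (fun p : R2n n × R2n n =>
        ((homogeneous q p.1 : ℂ) * dampedExp ε 0 p.1) * φ p.2) (volume.prod volume) :=
      (hq.integrable_homogeneous_mul hn (integrable_damped ε hε 0)
        (norm_dampedExp_le_one hε 0)).mul_prod φ.integrable
    refine (h0.bdd_mul (c := 1)
      (f := fun p : R2n n × R2n n => cexp (-I * (inner ℝ p.2 p.1 : ℝ)))
      (by fun_prop) (.of_forall fun p => ?_)).congr (.of_forall fun p => ?_)
    · simp [norm_exp]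
    · simp only [dampedExp_eq, inner_zero_left]
      simp
      ring
  have hswap := integral_integral_swap (f := fun x y => (homogeneous q x : ℂ) *
    dampedExp ε y x * φ y) hint
  have hl : ∀ x : R2n n, ∫ y, (homogeneous q x : ℂ) * dampedExp ε y x * φ y =
      (Real.exp (-(ε / 2) * ‖x‖ ^ 2) : ℝ) * ((homogeneous q x : ℂ) * testFourier φ x) := fun x => by
    rw [testFourier, ← integral_const_mul, ← integral_const_mul]
    refine integral_congr_ae (.of_forall fun y => ?_)
    simp only [dampedExp_eq]
    ring
  have hr : ∀ y : R2n n, ∫ x, (homogeneous q x : ℂ) * dampedExp ε y x * φ y =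
      (gaussReg q ε y : ℂ) * φ y := fun y => by
    rw [integral_mul_const, hq.integral_homogeneous_mul_dampedExp hn hε]
  simp_rw [hl, hr] at hswap
  exact hswap

/-- Both sides are limits of the damped pairing as ε → 0. The dominating functions are |F φ̂| and
C|y|⁻²|φ|, the latter integrable since 2 < 2n. -/
lemma IsProjective.pairing {q : R2n n → ℝ} {M : ℝ} (hq : IsProjective q M) (hn : 2 ≤ n)
    (φ : SchwartzMap (R2n n) ℂ) :
    ∫ y, (radonTransform q y : ℂ) * φ y = ∫ x, (homogeneous q x : ℂ) * testFourier φ x := by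
  have hn' : (2 : ℝ) ≤ n := by exact_mod_cast hn
  have : Nontrivial (R2n n) :=
    Module.nontrivial_of_finrank_pos (R := ℝ) (by rw [finrank_R2n]; omega)
  obtain ⟨C, hC, hC0⟩ := hq.exists_bound_radonTransform hn
  obtain ⟨D, hD⟩ := exists_bound_schwartz φ
  obtain ⟨D', hD'⟩ := exists_bound_testFourier φ
  have hF := hq.integrable_homogeneous_mul hn (integrable_testFourier φ) hD'
  have hlim1 : Tendsto (fun ε : ℝ => ∫ x, (Real.exp (-(ε / 2) * ‖x‖ ^ 2) : ℝ) *
      ((homogeneous q x : ℂ) * testFourier φ x)) (𝓝[>] 0)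
      (𝓝 (∫ x, (homogeneous q x : ℂ) * testFourier φ x)) := by
    refine tendsto_integral_filter_of_dominated_convergence
      (fun x => ‖(homogeneous q x : ℂ) * testFourier φ x‖) (.of_forall fun ε => ?_) ?_ hF.norm
      (.of_forall fun x => ?_)
    · exact AEStronglyMeasurable.mul (by fun_prop) hF.aestronglyMeasurable
    · filter_upwards [self_mem_nhdsWithin] with ε hε
      refine .of_forall fun x => ?_
      have hε : 0 < ε := hε
      rw [norm_mul, norm_real, Real.norm_of_nonneg (Real.exp_nonneg _)]
      refine mul_le_of_le_one_left (norm_nonneg _) (Real.exp_le_one_iff.2 ?_)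
      have : 0 ≤ ε / 2 * ‖x‖ ^ 2 := by positivity
      linarith
    · have hc : Continuous fun ε : ℝ => ((Real.exp (-(ε / 2) * ‖x‖ ^ 2) : ℝ) : ℂ) *
        ((homogeneous q x : ℂ) * testFourier φ x) := by fun_prop
      have := (hc.tendsto 0).mono_left (nhdsWithin_le_nhds (s := Ioi 0))
      simpa using this
  have hlim2 : Tendsto (fun ε : ℝ => ∫ y, (gaussReg q ε y : ℂ) * φ y) (𝓝[>] 0)
      (𝓝 (∫ y, (radonTransform q y : ℂ) * φ y)) := by
    have hbd : Integrable fun y : R2n n => ((C * ‖y‖ ^ (-2 : ℝ) : ℝ) : ℂ) * φ y := by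
      refine integrable_mul_of_norm_le_rpow (C := |C|) (α := 2) (by rw [finrank_R2n]; omega)
        (by norm_num) (by rw [finrank_R2n]; push_cast; linarith) (fun x _ => ?_)
        ?_ φ.integrable hD
      · rw [norm_real, norm_mul, Real.norm_eq_abs, Real.norm_of_nonneg (by positivity)]
      · exact (Measurable.aestronglyMeasurable (by fun_prop))
    refine tendsto_integral_filter_of_dominated_convergence
      (fun y => ‖((C * ‖y‖ ^ (-2 : ℝ) : ℝ) : ℂ) * φ y‖) ?_ ?_ hbd.norm ?_
    · filter_upwards [self_mem_nhdsWithin] with ε hε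
      refine AEStronglyMeasurable.mul ?_ φ.continuous.aestronglyMeasurable
      -- Measurability of `gaussReg` in y is read off from its expression as a parameter integral.
      have hm : AEStronglyMeasurable (fun y : R2n n => ∫ x, (homogeneous q x : ℂ) *
          dampedExp ε y x) volume := by
        refine AEStronglyMeasurable.integral_prod_right'
          (f := fun p : R2n n × R2n n => (homogeneous q p.2 : ℂ) * dampedExp ε p.1 p.2) ?_
        refine Measurable.aestronglyMeasurable (Measurable.mul ?_ ?_)
        · exact measurable_ofReal.comp (hq.measurable_homogeneous.comp measurable_snd)
        · unfold dampedExp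
          exact Continuous.measurable (by fun_prop)
      exact hm.congr (.of_forall fun y => hq.integral_homogeneous_mul_dampedExp hn hε y)
    · filter_upwards [self_mem_nhdsWithin] with ε hε
      filter_upwards [Measure.ae_ne volume (0 : R2n n)] with y hy
      rw [norm_mul, norm_mul, norm_real, norm_real]
      exact mul_le_mul_of_nonneg_right ((hC ε y hε hy).trans (le_abs_self _)) (norm_nonneg _)
    · filter_upwards [Measure.ae_ne volume (0 : R2n n)] with y hy
      exact ((continuous_ofReal.tendsto _).comp (hq.tendsto_gaussReg_zero hn hy)).mul_const _
  refine tendsto_nhds_unique hlim2 (hlim1.congr' ?_)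
  filter_upwards [self_mem_nhdsWithin] with ε hε
  exact hq.integral_damped_mul_testFourier hn hε φ

theorem IsProjective.isFourierFunction {q : R2n n → ℝ} {M : ℝ} (hq : IsProjective q M)
    (hn : 2 ≤ n) :
    IsFourierFunction (fun x => (homogeneous q x : ℂ)) fun y => (radonTransform q y : ℂ) := by
  have hn' : (2 : ℝ) ≤ n := by exact_mod_cast hn
  have : Nontrivial (R2n n) :=
    Module.nontrivial_of_finrank_pos (R := ℝ) (by rw [finrank_R2n]; omega)
  obtain ⟨C, -, hC⟩ := hq.exists_bound_radonTransform hn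
  have hcont := hq.continuousOn_radonTransform hn
  refine ⟨?_, ?_, hq.pairing hn, ?_⟩
  · exact hasPowerGrowth_of_norm_le (α := 2 * (n : ℝ) - 2) (by omega) (by linarith) (by linarith)
      (fun x _ => hq.norm_homogeneous_le x)
      (measurable_ofReal.comp hq.measurable_homogeneous).aestronglyMeasurable
  · refine hasPowerGrowth_of_norm_le (C := C) (α := 2) (by omega) (by norm_num) (by linarith)
      (fun x hx => ?_) ?_
    · rw [norm_real]; exact hC x hx
    · exact (measurable_ofReal.comp
        (measurable_of_continuousOn_compl_singleton 0 hcont)).aestronglyMeasurable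
  · exact continuous_ofReal.comp_continuousOn hcont

/-! ### Uniqueness, and invariant functions on the sphere. -/

/-- The continuous representative of a Fourier transform is unique off the origin. -/
theorem IsFourierFunction.eq_of_ne_zero {f g h : R2n n → ℂ} (hg : IsFourierFunction f g)
    (hh : IsFourierFunction f h) {x : R2n n} (hx : x ≠ 0) : g x = h x := by
  have hae : ∀ᵐ x, g x = h x := by
    refine ae_eq_of_integral_contDiff_smul_eq hg.growth_right.1 hh.growth_right.1
      fun u hu hcs => ?_
    have h1 : HasCompactSupport (ofRealCLM ∘ u) := hcs.comp_left rfl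
    have h2 : ContDiff ℝ (⊤ : ℕ∞) (ofRealCLM ∘ u) := by fun_prop
    have h3 := (hg.pairing (h1.toSchwartzMap h2)).trans (hh.pairing (h1.toSchwartzMap h2)).symm
    simpa [mul_comm] using h3
  exact Measure.eqOn_open_of_ae_eq (ae_restrict_of_ae hae) isOpen_ne hg.continuousOn
    hh.continuousOn hx

lemma exists_exp_mul_I_eq {c : ℂ} (hc : ‖c‖ = 1) :
    ∃ θ ∈ Icc (0 : ℝ) (2 * Real.pi), cexp (θ * I) = c := by
  have h : cexp (arg c * I) = c := by simpa [hc] using norm_mul_exp_arg_mul_I c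
  have h1 := neg_pi_lt_arg c
  have h2 := arg_le_pi c
  have hpi := Real.pi_pos
  by_cases h0 : 0 ≤ arg c
  · exact ⟨arg c, ⟨h0, by linarith⟩, h⟩
  · refine ⟨arg c + 2 * Real.pi, ⟨by linarith, by linarith⟩, ?_⟩
    push_cast
    rw [add_mul, Complex.exp_add, h, exp_two_pi_mul_I, mul_one]

lemma IsEvenInvariantOnSphere.exists_isProjective {f : R2n n → ℝ}
    (hf : IsEvenInvariantOnSphere f) : ∃ M, IsProjective (fun x => f (‖x‖⁻¹ • x)) M := by
  obtain ⟨M, hM⟩ := (isCompact_sphere (0 : R2n n) 1).exists_bound_of_continuousOn hf.continuousOn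
  have hmaps : MapsTo (fun x : R2n n => ‖x‖⁻¹ • x) {0}ᶜ (sphere 0 1) := fun x hx => by
    simpa using norm_smul_inv_norm (𝕜 := ℝ) hx
  -- At x = 0 the normalized vector is 0, off the sphere, so the value f 0 must be bounded
  -- separately.
  refine ⟨max M |f 0|, ⟨?_, fun x => ?_, fun c x hc => ?_⟩⟩
  · have h1 : ContinuousOn (fun x : R2n n => ‖x‖⁻¹) {0}ᶜ :=
      continuous_norm.continuousOn.inv₀ fun x hx => norm_ne_zero_iff.2 hx
    exact hf.continuousOn.comp (h1.smul continuousOn_id) hmaps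
  · by_cases hx : x = 0
    · simp [hx]
    · exact (hM _ (hmaps hx)).trans (le_max_left _ _)
  · by_cases hx : x = 0
    · have : cmul c (0 : R2n n) = 0 := by rw [← norm_eq_zero, norm_cmul, norm_zero, mul_zero]
      rw [hx, this]
    · have hcn : ‖c / (‖c‖ : ℂ)‖ = 1 := by simp [hc]
      obtain ⟨θ, hθ, hθc⟩ := exists_exp_mul_I_eq hcn
      rw [← hf.invariant θ hθ _ (hmaps hx), rot_eq_cmul, hθc, norm_cmul]
      congr 1
      simp only
      rw [← cmul_ofReal, ← cmul_ofReal, cmul_cmul, cmul_cmul]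
      congr 1
      push_cast
      rw [mul_inv]
      ring

lemma complexRadon_congr {f g : R2n n → ℝ} (h : ∀ x ∈ sphere (0 : R2n n) 1, f x = g x)
    (ξ : R2n n) : complexRadon f ξ = complexRadon g ξ := by
  refine integral_congr_ae (.of_forall fun θ => h _ ?_)
  have hθ := mem_sphere_zero_iff_norm.1 θ.2
  exact mem_sphere_zero_iff_norm.2 hθ

/-- The Fourier transform of `f · r^{-2n+2}` is `2π|y|⁻²` times the complex Radon transform. -/
theorem IsEvenInvariantOnSphere.isFourierFunction {f : R2n n → ℝ}
    (hf : IsEvenInvariantOnSphere f) (hn : 2 ≤ n) :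
    IsFourierFunction (fun x => (homExt f (-2 * (n : ℤ) + 2) x : ℂ))
      fun y => (radonTransform f y : ℂ) := by
  obtain ⟨M, hq⟩ := hf.exists_isProjective
  have h : radonTransform f = radonTransform fun x => f (‖x‖⁻¹ • x) := by
    funext y
    simp only [radonTransform]
    congr 1
    refine complexRadon_congr (fun x hx => ?_) y
    rw [mem_sphere_zero_iff_norm.1 hx, inv_one, one_smul]
  rw [h]
  exact hq.isFourierFunction hn

lemma radonTransform_of_norm_one (f : R2n n → ℝ) {ξ : R2n n}
    (hξ : ξ ∈ sphere (0 : R2n n) 1) :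
    radonTransform f ξ = 2 * Real.pi * complexRadon f ξ := by
  rw [radonTransform, mem_sphere_zero_iff_norm.1 hξ]; simp

lemma radonTransform_smul (f : R2n n → ℝ) {t : ℝ} (ht : t ≠ 0) (x : R2n n) :
    radonTransform f (t • x) = |t| ^ (-2 : ℤ) * radonTransform f x := by
  rw [radonTransform, radonTransform, complexRadon_smul f x ht, norm_smul, Real.norm_eq_abs,
    zpow_neg]
  norm_cast
  rw [mul_pow, div_eq_mul_inv, mul_inv]
  ring

/-! ### Star bodies and the volume of sections. -/

lemma exists_mem_frontier_of_isPreconnected {X : Type*} [TopologicalSpace X] {s K : Set X}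
    (hs : IsPreconnected s) (hK : IsClosed K) {a b : X} (ha : a ∈ s) (haK : a ∈ K) (hb : b ∈ s)
    (hbK : b ∉ K) : ∃ c ∈ s, c ∈ frontier K := by
  by_contra! hno
  have hint : ∀ c ∈ s, c ∈ K → c ∈ interior K := fun c hc hcK => by
    by_contra hci
    exact hno c hc ⟨subset_closure hcK, hci⟩
  obtain ⟨c, -, hc1, hc2⟩ := hs (interior K) Kᶜ isOpen_interior hK.isOpen_compl
    (fun c hc => (em (c ∈ K)).imp (hint c hc) id) ⟨a, ha, hint a ha haK⟩ ⟨b, hb, hbK⟩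
  exact hc2 (interior_subset hc1)

lemma IsStarBody.gauge_pos {K : Set (R2n n)} (hK : IsStarBody K) {x : R2n n} (hx : x ≠ 0) :
    0 < gauge K x :=
  (_root_.gauge_pos (absorbent_nhds_zero (mem_interior_iff_mem_nhds.1 hK.zero_mem_interior))
    (NormedSpace.isVonNBounded_of_isBounded ℝ hK.isCompact.isBounded)).2 hx

/-- If x ∉ K, write x = rk with k ∈ K and 0 < r < 1. Along the line through k, membership in K
changes between a far negative point and 0, between 0 and x, and between x and k. This gives three
boundary points, while the line has only two. -/
lemma IsStarBody.mem_of_gauge_lt_one {K : Set (R2n n)} (hK : IsStarBody K) {x : R2n n}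
    (hx : gauge K x < 1) : x ∈ K := by
  by_contra hxK
  have h0 : (0 : R2n n) ∈ K := interior_subset hK.zero_mem_interior
  have hx0 : x ≠ 0 := fun h => hxK (h ▸ h0)
  have hcl := hK.isCompact.isClosed
  have habs : Absorbent ℝ K :=
    absorbent_nhds_zero (mem_interior_iff_mem_nhds.1 hK.zero_mem_interior)
  obtain ⟨r, hr0, hr1, hr⟩ := exists_lt_of_gauge_lt habs hx
  obtain ⟨k, hk, rfl⟩ := hr
  simp only at hxK hx0
  have hk0 : k ≠ 0 := fun h => hx0 (by simp [h])
  -- a point of the negative ray outside `K`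
  obtain ⟨T, hT0, hT⟩ : ∃ T : ℝ, T < 0 ∧ T • k ∉ K := by
    obtain ⟨R, hR⟩ := hK.isCompact.isBounded.exists_norm_le
    refine ⟨-((|R| + 1) / ‖k‖), ?_, fun h => ?_⟩
    · have : 0 < ‖k‖ := norm_pos_iff.2 hk0
      have : 0 < (|R| + 1) / ‖k‖ := by positivity
      linarith
    · have h1 := hR _ h
      rw [norm_smul, norm_neg, norm_div, norm_norm, div_mul_cancel₀ _ (norm_ne_zero_iff.2 hk0),
        Real.norm_of_nonneg (by positivity)] at h1
      linarith [le_abs_self R]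
  have hfr : ∀ a b : ℝ, a ≤ b → ((a • k ∈ K ∧ b • k ∉ K) ∨ (b • k ∈ K ∧ a • k ∉ K)) →
      ∃ t ∈ Icc a b, t • k ∈ frontier K := by
    intro a b hab h
    have hpre : IsPreconnected ((fun t : ℝ => t • k) '' Icc a b) :=
      isPreconnected_Icc.image _ (by fun_prop)
    have ha := mem_image_of_mem (fun t : ℝ => t • k) (left_mem_Icc.2 hab)
    have hb := mem_image_of_mem (fun t : ℝ => t • k) (right_mem_Icc.2 hab)
    rcases h with h | h
    · obtain ⟨_, ⟨t, ht, rfl⟩, hc⟩ := exists_mem_frontier_of_isPreconnected hpre hcl ha h.1 hb h.2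
      exact ⟨t, ht, hc⟩
    · obtain ⟨_, ⟨t, ht, rfl⟩, hc⟩ := exists_mem_frontier_of_isPreconnected hpre hcl hb h.1 ha h.2
      exact ⟨t, ht, hc⟩
  have hfK : ∀ {z : R2n n}, z ∈ frontier K → z ∈ K := fun h => hcl.frontier_subset h
  have hf0 : ∀ {t : ℝ}, t • k ∈ frontier K → t ≠ 0 := by
    rintro t h rfl
    rw [zero_smul] at h
    exact h.2 hK.zero_mem_interior
  have h0' : (0 : ℝ) • k ∈ K := by rwa [zero_smul]
  obtain ⟨t₁, ht₁, hk₁⟩ := hfr T 0 hT0.le (Or.inr ⟨h0', hT⟩)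
  obtain ⟨t₂, ht₂, hk₂⟩ := hfr 0 r hr0.le (Or.inl ⟨h0', hxK⟩)
  obtain ⟨t₃, ht₃, hk₃⟩ := hfr r 1 hr1.le (Or.inr ⟨by rwa [one_smul], hxK⟩)
  have h1 : t₁ < 0 := lt_of_le_of_ne ht₁.2 (hf0 hk₁)
  have h2 : 0 < t₂ := lt_of_le_of_ne ht₂.1 (hf0 hk₂).symm
  have h3 : t₂ < r := lt_of_le_of_ne ht₂.2 (by rintro rfl; exact hxK (hfK hk₂))
  have h4 : r < t₃ := lt_of_le_of_ne ht₃.1 (by rintro rfl; exact hxK (hfK hk₃))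
  have hcard := hK.line_frontier k hk0
  have hinj : Function.Injective fun t : ℝ => t • k := smul_left_injective ℝ hk0
  have hsub : (fun t : ℝ => t • k) '' ({t₁, t₂, t₃} : Set ℝ) ⊆
      frontier K ∩ {y | ∃ t : ℝ, y = t • k} := by
    rintro _ ⟨t, ht, rfl⟩
    refine ⟨?_, t, rfl⟩
    rcases ht with rfl | rfl | rfl <;> assumption
  -- An infinite set has `ncard` 0, so the value 2 forces the intersection to be finite.
  have hle := ncard_le_ncard hsub (finite_of_ncard_ne_zero (by rw [hcard]; norm_num))
  rw [ncard_image_of_injective _ hinj, hcard,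
    ncard_eq_three.2 ⟨t₁, t₂, t₃, by linarith, by linarith, by linarith, rfl⟩] at hle
  norm_num at hle

/-- The case of gauge exactly 1 follows by closedness, approximating x by tx with t increasing to 1.
-/
lemma IsStarBody.mem_iff_gauge_le_one {K : Set (R2n n)} (hK : IsStarBody K) {x : R2n n} :
    x ∈ K ↔ gauge K x ≤ 1 := by
  refine ⟨gauge_le_one_of_mem, fun h => ?_⟩
  have hlim : Tendsto (fun t : ℝ => t • x) (𝓝[<] 1) (𝓝 x) := by
    have hc : Continuous fun t : ℝ => t • x := by fun_prop
    simpa using (hc.tendsto 1).mono_left nhdsWithin_le_nhds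
  refine hK.isCompact.isClosed.mem_of_tendsto hlim ?_
  filter_upwards [Ioo_mem_nhdsLT (zero_lt_one (α := ℝ))] with t ht
  refine hK.mem_of_gauge_lt_one ?_
  rw [gauge_smul_of_nonneg ht.1.le, smul_eq_mul]
  exact (mul_le_of_le_one_right ht.1.le h).trans_lt ht.2

lemma IsComplexStarBody.isEvenInvariantOnSphere {K : Set (R2n n)} (hK : IsComplexStarBody K)
    (hsymm : IsOriginSymmetric K) (p : ℤ) :
    IsEvenInvariantOnSphere fun x => gauge K x ^ p where
  continuousOn := hK.continuous_gauge.continuousOn.zpow₀ p fun x hx =>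
    Or.inl (hK.gauge_pos (ne_zero_of_mem_unit_sphere ⟨x, hx⟩)).ne'
  even x _ := by rw [gauge_neg hsymm]
  invariant θ hθ x _ := by rw [hK.gauge_rot θ hθ x]

lemma homExt_gauge_zpow (K : Set (R2n n)) {p : ℤ} (hp : p ≠ 0) (x : R2n n) :
    homExt (fun x => gauge K x ^ p) p x = gauge K x ^ p := by
  by_cases hx : x = 0
  · simp [hx, homExt, zero_zpow p hp]
  · have hx' : ‖x‖ ≠ 0 := norm_ne_zero_iff.2 hx
    rw [homExt, gauge_smul_of_nonneg (by positivity), smul_eq_mul, ← mul_zpow]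
    congr 1
    field_simp

/-- Polar coordinates in H_ξ, whose dimension 2n-2 supplies both the exponent of the gauge and the
denominator. -/
lemma IsStarBody.sectionVolume_eq {K : Set (R2n n)} (hK : IsStarBody K) (hn : 2 ≤ n)
    {ξ : R2n n} (hξ : ξ ∈ sphere (0 : R2n n) 1) :
    sectionVolume K ξ =
      complexRadon (fun x => gauge K x ^ (-2 * (n : ℤ) + 2)) ξ / (2 * (n - 1)) := by
  have hfr := finrank_hyperplane_of_norm_one ξ (mem_sphere_zero_iff_norm.1 hξ)
  have : Nontrivial (hyperplane ξ) := Module.nontrivial_of_finrank_pos (R := ℝ)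
    (by rw [hfr]; omega)
  have hset : {z : hyperplane ξ | (z : R2n n) ∈ K} = {z : hyperplane ξ | gauge K z ≤ 1} := by
    ext z; exact hK.mem_iff_gauge_le_one
  have hfin : volume {z : hyperplane ξ | gauge K z ≤ 1} ≠ ⊤ := by
    rw [← hset]
    obtain ⟨R, hR⟩ := hK.isCompact.isBounded.exists_norm_le
    have hsub : {z : hyperplane ξ | (z : R2n n) ∈ K} ⊆ closedBall 0 R := fun z hz =>
      mem_closedBall_zero_iff.2 (hR _ hz)
    exact ((measure_mono hsub).trans_lt measure_closedBall_lt_top).ne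
  rw [sectionVolume, hset, measureReal_sublevel volume (fun z : hyperplane ξ => gauge K z)
    (hK.continuous_gauge.comp continuous_subtype_val)
    (fun z hz => hK.gauge_pos (by simpa using hz))
    (fun r z hr => by rw [Submodule.coe_smul, gauge_smul_of_nonneg hr.le, smul_eq_mul]) hfin, hfr,
    complexRadon]
  congr 1
  · refine integral_congr_ae (.of_forall fun θ => ?_)
    have : (-2 * (n : ℤ) + 2) = -((2 * n - 2 : ℕ) : ℤ) := by
      rw [Nat.cast_sub (by omega)]; push_cast; ring
    simp only
    rw [this, zpow_neg, zpow_natCast]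
  · rw [Nat.cast_sub (by omega)]; push_cast; ring

end ComplexBody

end

theorem mainTheorem6 (n : ℕ) (hn : 2 ≤ n) :
    (∀ K : Set (ComplexBody.R2n n),
      ComplexBody.IsComplexStarBody K → ComplexBody.IsOriginSymmetric K →
      (∃ g : ComplexBody.R2n n → ℂ,
        ComplexBody.IsFourierFunction
          (fun x => ((gauge K x ^ (-2 * (n : ℤ) + 2) : ℝ) : ℂ)) g) ∧
      (∀ g : ComplexBody.R2n n → ℂ,
        ComplexBody.IsFourierFunction
          (fun x => ((gauge K x ^ (-2 * (n : ℤ) + 2) : ℝ) : ℂ)) g →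
        ∀ ξ ∈ Metric.sphere (0 : ComplexBody.R2n n) 1,
          (ComplexBody.sectionVolume K ξ : ℂ) =
            1 / (4 * (Real.pi : ℂ) * ((n : ℂ) - 1)) * g ξ)) ∧
    (∀ f : ComplexBody.R2n n → ℝ, ComplexBody.IsEvenInvariantOnSphere f →
      (∃ g : ComplexBody.R2n n → ℂ,
        ComplexBody.IsFourierFunction
          (fun x => (ComplexBody.homExt f (-2 * (n : ℤ) + 2) x : ℂ)) g) ∧
      (∀ g : ComplexBody.R2n n → ℂ,
        ComplexBody.IsFourierFunction
          (fun x => (ComplexBody.homExt f (-2 * (n : ℤ) + 2) x : ℂ)) g →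
        ComplexBody.IsEvenHomogeneous g (-2) ∧
        ∀ ξ ∈ Metric.sphere (0 : ComplexBody.R2n n) 1,
          (ComplexBody.complexRadon f ξ : ℂ) = 1 / (2 * (Real.pi : ℂ)) * g ξ)) := by
  have hpi : (Real.pi : ℂ) ≠ 0 := by exact_mod_cast Real.pi_ne_zero
  refine ⟨fun K hK hsymm => ?_, fun f hf => ?_⟩
  · have h := (hK.isEvenInvariantOnSphere hsymm (-2 * (n : ℤ) + 2)).isFourierFunction hn
    simp_rw [ComplexBody.homExt_gauge_zpow K (p := -2 * (n : ℤ) + 2) (by omega)] at h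
    refine ⟨⟨_, h⟩, fun g hg ξ hξ => ?_⟩
    have hn1 : (n : ℂ) - 1 ≠ 0 := by
      rw [sub_ne_zero]; norm_cast; omega
    -- The transform is 2π times the Radon transform on the sphere, and the volume is that Radon
    -- transform over 2(n-1); hence the factor 1/(4π(n-1)).
    rw [hg.eq_of_ne_zero h (ne_zero_of_mem_unit_sphere ⟨ξ, hξ⟩),
      ComplexBody.radonTransform_of_norm_one _ hξ, hK.sectionVolume_eq hn hξ]
    push_cast
    field_simp
    ring
  · have h := hf.isFourierFunction hn
    refine ⟨⟨_, h⟩, fun g hg => ⟨fun t x ht hx => ?_, fun ξ hξ => ?_⟩⟩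
    · rw [hg.eq_of_ne_zero h (smul_ne_zero ht hx), hg.eq_of_ne_zero h hx,
        ComplexBody.radonTransform_smul f ht x, Complex.ofReal_mul]
    · rw [hg.eq_of_ne_zero h (ne_zero_of_mem_unit_sphere ⟨ξ, hξ⟩),
        ComplexBody.radonTransform_of_norm_one f hξ]
      push_cast
      field_simp
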